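/- Let $\Bbbk$ be a field, $0\ne v\in\Bbbk$, and let $[r]=\sum_{t=0}^{r-1}v^{-(r-1)+2t}$ for $r\ge 0$, $[-r]=-[r]$, be the balanced quantum integers. Let $n\ge 0$ be such that $[n]!=[1][2]\cdots[n]\neq 0$ in $\Bbbk$. Let $V$ have basis $y_1,y_{-1}$, with operators $F y_1=y_{-1}$, $F y_{-1}=0$, $K^{-1}y_{\pm1}=v^{\mp1}y_{\pm1}$, and let $F$ and $K^{-1}$ act on tensor powers of $V$ by $\Delta(F)=F\otimes K^{-1}+1\otimes F$ and $\Delta(K^{-1})=K^{-1}\otimes K^{-1}$ (with $F=0$, $K^{-1}=1$ on $V^{\otimes 0}=\Bbbk$). Let $\langle-,-\rangle$ be the symmetric bilinear form for which the tensors $y_{i_1}\otimes\cdots\otimes y_{i_l}$ are orthonormal. A vector in the span of the $y_{i_1}\otimes\cdots\otimes y_{i_l}$ with $i_1+\cdots+i_l=i$ has weight $i$; for $b$ of weight $i$ put $\Phi_1(b)=b\otimes y_1$, $\Phi_2(b)=[i]\,b\otimes y_{-1}-v^{i}Fb\otimes y_1$. A $1$-factor of length $l$ is a sequence $\alpha=(\alpha_1,\dots,\alpha_l)$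 in $\{1,-1\}$ with all partial sums $\ge 0$. Indices $i<j$ are paired in $\alpha$ if $\alpha_i=1$ and $j$ is the smallest index $>i$ with $\alpha_i+\cdots+\alpha_j=0$; indices that are not in any pair are defects. Write $\beta\le\alpha$ if every partial sum of $\beta$ is at most the corresponding partial sum of $\alpha$, and call $\beta$ $\alpha$-compatible if $\beta_i=-\beta_j$ for every pair $(i,j)$ of $\alpha$. Put $\omega(\alpha)=\Upsilon_l\cdots\Upsilon_1(1)$, where $\Upsilon_i=\Phi_1$ if $\alpha_i=1$ and $\Upsilon_i=\Phi_2$ if $\alpha_i=-1$. Let $N(\alpha)\in V^{\otimes l}$ be the vector of the link diagram of $\alpha$: the tensor product, in order, of a factor $y_1$ for each defect and, for each outermost link (one not nested in another link), of the vector $\Psi(b)=\Phi_2(y_1\otimes b)=y_1\otimes b\otimes y_{-1}-v\,y_{-1}\otimes b\otimes y_1$, where $b$ is the vector of the diagram nested inside that link, constructed recursively. Let $m\ge 0$ and $0\le l\le n$. Then there are unique scalars $\pi_{\alpha,\beta}$, for $\alpha,\beta$ $1$-factors of length $l$ with $m$ pairings, such that $N(\alpha)=\sum_\beta \pi_{\alpha,\beta}\,\omega(\beta)$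 for all $\alpha$; moreover $\pi_{\alpha,\beta}=0$ unless $\beta\le\alpha$. For all such $\alpha,\beta$ one has $\langle\omega(\beta),\omega(\beta)\rangle\ne0$ and \[ \pi_{\alpha,\beta}=\frac{\langle N(\alpha),\omega(\beta)\rangle}{\langle\omega(\beta),\omega(\beta)\rangle}=\begin{cases}\displaystyle\prod_{j=1}^m\frac{[s'_j]}{[s_j][s_j+1]}&\text{if $\beta$ is $\alpha$-compatible,}\\[2mm]0&\text{otherwise,}\end{cases} \] where $i_1<\dots<i_m$ are the positions of the entries $-1$ of $\beta$, $s_j=\beta_1+\cdots+\beta_{i_j-1}$, and $s'_j=-s_j$ if $\alpha_{i_j}=1$, $s'_j=s_j+1$ if $\alpha_{i_j}=-1$; all the denominators $[s_j][s_j+1]$ are nonzero. If $\beta$ is $\alpha$-compatible, then $\pi_{\alpha,\beta}$ is, up to sign, the reciprocal of a product $\prod_{j=1}^m[r_j]$ of nonzero quantum integers, with $r_j\in\{s_j,s_j+1\}$; in particular $\pi_{\alpha,\beta}\ne 0$ in that case. -/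

import Mathlib

open scoped BigOperators

noncomputable section

namespace OrthTL

/-! ### Quantum integers -/

/-- The balanced quantum integer `[n]` for a natural number `n`. -/
def qnat {k : Type*} [Field k] (v : k) (n : ℕ) : k :=
  ∑ t ∈ Finset.range n, v ^ (-((n : ℤ) - 1) + 2 * (t : ℤ))

/-- The quantum integer `[z]` for an integer `z`, with `[-n] = -[n]`. -/
def qint {k : Type*} [Field k] (v : k) : ℤ → k
  | Int.ofNat n => qnat v n
  | Int.negSucc n => -qnat v (n + 1)

/-- The quantum factorial `[n]! = [1][2]⋯[n]`. -/
def qfact {k : Type*} [Field k] (v : k) (n : ℕ) : k :=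
  ∏ i ∈ Finset.range n, qnat v (i + 1)

/-! ### Tensor space

`V` is the two-dimensional module with basis `y_1`, `y_{-1}` (indexed by the two units of `ℤ`).
The tensor powers `V ⊗ ⋯ ⊗ V` are the homogeneous components of the tensor algebra of `V`, and
`⊗` is its product. -/

/-- The two-dimensional simple module `V = V(1)`. -/
abbrev VMod (k : Type*) [Field k] : Type _ := ℤˣ → k

/-- The basis `y_1, y_{-1}` of `V`. -/
def yBasis (k : Type*) [Field k] : Module.Basis ℤˣ k (VMod k) := Pi.basisFun k ℤˣ

/-- The direct sum of all the tensor powers of `V`. -/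
abbrev Tens (k : Type*) [Field k] : Type _ := TensorAlgebra k (VMod k)

/-- The basis vector `y_ε` of `V`, as a tensor of degree one. -/
def yTens (k : Type*) [Field k] (ε : ℤˣ) : Tens k := TensorAlgebra.ι k (yBasis k ε)

/-- The action of `F` on `V`: `y_1 ↦ y_{-1}`, `y_{-1} ↦ 0`. -/
def FV (k : Type*) [Field k] : VMod k →ₗ[k] VMod k :=
  (yBasis k).constr k fun ε => if ε = 1 then yBasis k (-1) else 0

/-- The action of `K⁻¹` on `V`: `y_ε ↦ v^{-ε} y_ε`. -/
def KinvV {k : Type*} [Field k] (v : k) : VMod k →ₗ[k] VMod k :=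
  (yBasis k).constr k fun ε => v ^ (-(ε : ℤ)) • yBasis k ε

/-- The action of `K⁻¹` on tensor space, `Δ(K⁻¹) = K⁻¹ ⊗ K⁻¹`. -/
def Kinv {k : Type*} [Field k] (v : k) : Tens k →ₐ[k] Tens k :=
  TensorAlgebra.lift k ((TensorAlgebra.ι k).comp (KinvV v))

/-- Auxiliary algebra map `x ↦ !![x, F x; 0, K⁻¹ x]`. It is multiplicative exactly because
`Δ(F) = F ⊗ K⁻¹ + 1 ⊗ F` and `Δ(K⁻¹) = K⁻¹ ⊗ K⁻¹`. -/
def triang {k : Type*} [Field k] (v : k) : Tens k →ₐ[k] Matrix (Fin 2) (Fin 2) (Tens k) :=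
  TensorAlgebra.lift k
    { toFun := fun x =>
        !![TensorAlgebra.ι k x, TensorAlgebra.ι k (FV k x); 0, TensorAlgebra.ι k (KinvV v x)]
      map_add' := by
        intro x x'
        ext i j
        fin_cases i <;> fin_cases j <;> simp
      map_smul' := by
        intro c x
        ext i j
        fin_cases i <;> fin_cases j <;> simp }

/-- The action of `F` on tensor space, given by the coproduct `Δ(F) = F ⊗ K⁻¹ + 1 ⊗ F`;
see `actF_one`, `actF_ι` and `actF_mul`. -/
def actF {k : Type*} [Field k] (v : k) (x : Tens k) : Tens k := triang v x 0 1

theorem triang_entries {k : Type*} [Field k] (v : k) (x : Tens k) :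
    triang v x 0 0 = x ∧ triang v x 1 0 = 0 ∧ triang v x 1 1 = Kinv v x := by
  induction x using TensorAlgebra.induction with
  | algebraMap r => simp [Matrix.algebraMap_eq_diagonal]
  | ι x => simp [triang, Kinv]
  | mul a b ha hb =>
    obtain ⟨h1, h2, h3⟩ := ha
    obtain ⟨g1, g2, g3⟩ := hb
    simp [Matrix.mul_apply, Fin.sum_univ_two, h1, h2, h3, g1, g2, g3]
  | add a b ha hb =>
    obtain ⟨h1, h2, h3⟩ := ha
    obtain ⟨g1, g2, g3⟩ := hb
    simp [h1, h2, h3, g1, g2, g3]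

theorem actF_one {k : Type*} [Field k] (v : k) : actF v (1 : Tens k) = 0 := by
  simp [actF]

theorem actF_ι {k : Type*} [Field k] (v : k) (x : VMod k) :
    actF v (TensorAlgebra.ι k x) = TensorAlgebra.ι k (FV k x) := by
  simp [actF, triang]

theorem actF_mul {k : Type*} [Field k] (v : k) (a b : Tens k) :
    actF v (a * b) = actF v a * Kinv v b + a * actF v b := by
  obtain ⟨h1, -, -⟩ := triang_entries v a
  obtain ⟨-, -, g3⟩ := triang_entries v b
  simp only [actF, map_mul, Matrix.mul_apply, Fin.sum_univ_two, h1, g3]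
  rw [add_comm]

/-- The symmetric bilinear form on tensor space for which the tensors
`y_{i_1} ⊗ ⋯ ⊗ y_{i_l}` form an orthonormal basis. -/
def form {k : Type*} [Field k] (x x' : Tens k) : k :=
  ((yBasis k).tensorAlgebra.repr x).sum fun w c => c * (yBasis k).tensorAlgebra.repr x' w

theorem form_basis {k : Type*} [Field k] (w w' : List ℤˣ) :
    form (w.map (yTens k)).prod (w'.map (yTens k)).prod = if w = w' then 1 else 0 := by
  have h : ∀ u : List ℤˣ,
      (u.map (yTens k)).prod = (yBasis k).tensorAlgebra (FreeMonoid.ofList u) := by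
    intro u
    have h1 : (yBasis k).tensorAlgebra (FreeMonoid.ofList u) =
        (TensorAlgebra.equivFreeAlgebra (yBasis k)).symm
          ((u.map (FreeAlgebra.ι k)).prod) := by
      simp only [Module.Basis.tensorAlgebra, Module.Basis.map_apply]
      change (TensorAlgebra.equivFreeAlgebra (yBasis k)).symm
        (FreeAlgebra.equivMonoidAlgebraFreeMonoid.symm
          (MonoidAlgebra.of k _ (FreeMonoid.ofList u))) = _
      simp [FreeAlgebra.equivMonoidAlgebraFreeMonoid, FreeMonoid.lift_apply]
    rw [h1, map_list_prod, List.map_map]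
    congr 2
    ext a
    simp [yTens]
  rw [h, h, form, Module.Basis.repr_self, Module.Basis.repr_self,
    Finsupp.sum_single_index (by simp), one_mul]
  by_cases hw : w = w'
  · subst hw
    simp
  · rw [if_neg hw, Finsupp.single_eq_of_ne]
    exact fun h' => hw (FreeMonoid.ofList.injective h')

/-- `Φ_1(b) = b ⊗ y_1`. -/
def Phi1 {k : Type*} [Field k] (b : Tens k) : Tens k := b * yTens k 1

/-- `Φ_2(b) = [i] b ⊗ y_{-1} - v^i F b ⊗ y_1`, where `i` is the weight of `b`. -/
def Phi2 {k : Type*} [Field k] (v : k) (i : ℤ) (b : Tens k) : Tens k :=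
  qint v i • (b * yTens k (-1)) - v ^ i • (actF v b * yTens k 1)

/-- The nesting `Ψ(b) = Φ_2(y_1 ⊗ b)` of an invariant `b` (so that `y_1 ⊗ b` has weight `1`). -/
def Psi {k : Type*} [Field k] (v : k) (b : Tens k) : Tens k := Phi2 v 1 (yTens k 1 * b)

/-! ### The two families of maximal vectors, on words in `1, -1` -/

/-- `Υ_l ⋯ Υ_1 (1)`, processing the letters from left to right; the first component is the
weight of the vector in the second component. -/
def omaxStep {k : Type*} [Field k] (v : k) (s : ℤ × Tens k) (a : ℤˣ) : ℤ × Tens k :=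
  (s.1 + (a : ℤ), if a = 1 then Phi1 s.2 else Phi2 v s.1 s.2)

/-- The orthogonal maximal vector of a word. -/
def omaxWord {k : Type*} [Field k] (v : k) (w : List ℤˣ) : Tens k :=
  (w.foldl (omaxStep v) (0, 1)).2

/-- One step in the left-to-right matching of a word. The state `[t_r, …, t_1, t_0]` is the
list of tensors of the closed link diagrams separated by the `r` entries `1` that are still
unmatched. A letter `1` opens a new, empty, closed part; a letter `-1` is linked to the last
unmatched `1`, so that `t_r` is nested in the new link, which is juxtaposed to `t_{r-1}`. -/
def natStep {k : Type*} [Field k] (v : k) (s : List (Tens k)) (a : ℤˣ) : List (Tens k) :=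
  if a = 1 then 1 :: s
  else match s with
    | t :: u :: rest => (u * Psi v t) :: rest
    | s => s

/-- `t_0 ⊗ y_1 ⊗ t_1 ⊗ y_1 ⊗ ⋯ ⊗ y_1 ⊗ t_r`: the unmatched entries are the defects. -/
def natClose {k : Type*} [Field k] : List (Tens k) → Tens k
  | [] => 1
  | [t] => t
  | t :: u :: rest => natClose (u :: rest) * yTens k 1 * t

/-- The maximal vector given by the link diagram of a word. -/
def natWord {k : Type*} [Field k] (v : k) (w : List ℤˣ) : Tens k :=
  natClose (w.foldl (natStep v) [1])

/-- A word is closed if it is a juxtaposition of nestings, i.e. its link diagram has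
no defects. -/
inductive ClosedWord : List ℤˣ → Prop
  | nil : ClosedWord []
  | link {w e : List ℤˣ} : ClosedWord w → ClosedWord e → ClosedWord (w ++ 1 :: (e ++ [-1]))

theorem natStep_closed {k : Type*} [Field k] (v : k) {w : List ℤˣ} (hw : ClosedWord w) :
    ∃ x : Tens k, ∀ (t : Tens k) (s : List (Tens k)),
      w.foldl (natStep v) (t :: s) = (t * x) :: s := by
  induction hw with
  | nil => exact ⟨1, by simp⟩
  | link _ _ hw he =>
    obtain ⟨x, hx⟩ := hw
    obtain ⟨z, hz⟩ := he
    refine ⟨x * Psi v (1 * z), fun t s => ?_⟩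
    have h : (-1 : ℤˣ) ≠ 1 := by decide
    simp [List.foldl_append, hx, natStep, hz, h, mul_assoc]

theorem natStep_closed' {k : Type*} [Field k] (v : k) {w : List ℤˣ} (hw : ClosedWord w)
    (t : Tens k) (s : List (Tens k)) :
    w.foldl (natStep v) (t :: s) = (t * natWord v w) :: s := by
  obtain ⟨x, hx⟩ := natStep_closed v hw
  simp [natWord, hx, natClose]

theorem natState_ne_nil {k : Type*} [Field k] (v : k) (w : List ℤˣ) (s : List (Tens k))
    (hs : s ≠ []) : w.foldl (natStep v) s ≠ [] := by
  induction w generalizing s with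
  | nil => simpa using hs
  | cons a w ih =>
    refine ih _ ?_
    unfold natStep
    split_ifs
    · simp
    · split
      · simp
      · exact hs

/-- The empty diagram gives the scalar `1`. -/
theorem natWord_nil {k : Type*} [Field k] (v : k) : natWord v [] = (1 : Tens k) := rfl

/-- Appending a defect appends a tensor factor `y_1`. -/
theorem natWord_defect {k : Type*} [Field k] (v : k) (w : List ℤˣ) :
    natWord v (w ++ [1]) = natWord v w * yTens k 1 := by
  unfold natWord
  rw [List.foldl_append]
  have h := natState_ne_nil v w [(1 : Tens k)] (by simp)
  cases hs : w.foldl (natStep v) [(1 : Tens k)] with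
  | nil => exact absurd hs h
  | cons t s => simp [natStep, natClose]

/-- Appending a link around a closed diagram appends the corresponding nesting. -/
theorem natWord_link {k : Type*} [Field k] (v : k) (w : List ℤˣ) {e : List ℤˣ}
    (he : ClosedWord e) :
    natWord v (w ++ 1 :: (e ++ [-1])) = natWord v w * Psi v (natWord v e) := by
  unfold natWord
  rw [List.foldl_append]
  have h := natState_ne_nil v w [(1 : Tens k)] (by simp)
  have h1 : (-1 : ℤˣ) ≠ 1 := by decide
  cases hs : w.foldl (natStep v) [(1 : Tens k)] with
  | nil => exact absurd hs h
  | cons t s =>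
    have hstep : natStep v (t :: s) 1 = 1 :: t :: s := by simp [natStep]
    rw [List.foldl_cons, hstep, List.foldl_append, natStep_closed' v he, List.foldl_cons,
      List.foldl_nil, one_mul]
    change natClose (natStep v (natWord v e :: t :: s) (-1)) =
      natClose (t :: s) * Psi v (natWord v e)
    cases s with
    | nil => simp [natStep, natClose, h1]
    | cons u s => simp [natStep, natClose, h1, mul_assoc]

/-! ### 1-factors -/

/-- `α` is a 1-factor of length `l`: all partial sums are nonnegative. -/
def IsOneFactor {l : ℕ} (α : Fin l → ℤˣ) : Prop :=
  ∀ i, 0 ≤ ∑ j ∈ Finset.Iic i, (α j : ℤ)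

/-- The indices `(i, j)` are paired: `α_i = 1` and `j` is the smallest index greater than `i`
with `α_i + ⋯ + α_j = 0`. -/
def Paired {l : ℕ} (α : Fin l → ℤˣ) (i j : Fin l) : Prop :=
  α i = 1 ∧ i < j ∧ ∑ t ∈ Finset.Icc i j, (α t : ℤ) = 0 ∧
    ∀ j', i < j' → j' < j → ∑ t ∈ Finset.Icc i j', (α t : ℤ) ≠ 0

/-- The number of pairings. -/
def numPairings {l : ℕ} (α : Fin l → ℤˣ) : ℕ :=
  {p : Fin l × Fin l | Paired α p.1 p.2}.ncard

/-- The 1-factors of length `l` with `m` pairings (that is, of shape `(l - m, m)`). -/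
structure OneFactor (l m : ℕ) where
  entry : Fin l → ℤˣ
  isOneFactor : IsOneFactor entry
  numPairings_eq : numPairings entry = m

theorem OneFactor.entry_injective (l m : ℕ) :
    Function.Injective (OneFactor.entry : OneFactor l m → Fin l → ℤˣ) := by
  rintro ⟨a, _, _⟩ ⟨b, _, _⟩ h
  cases h
  rfl

instance (l m : ℕ) : Finite (OneFactor l m) :=
  Finite.of_injective _ (OneFactor.entry_injective l m)

instance (l m : ℕ) : Fintype (OneFactor l m) := Fintype.ofFinite _

/-- The partial order on 1-factors: comparison of all partial sums. -/
def Below {l m : ℕ} (β α : OneFactor l m) : Prop :=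
  ∀ i, ∑ j ∈ Finset.Iic i, (β.entry j : ℤ) ≤ ∑ j ∈ Finset.Iic i, (α.entry j : ℤ)

/-- `β` is `α`-compatible: for every pairing in `α`, the corresponding entries of `β` have
opposite signs. -/
def Compatible {l m : ℕ} (α β : OneFactor l m) : Prop :=
  ∀ i j, Paired α.entry i j → β.entry i = -β.entry j

/-- The positions of the entries `-1` of `β`. -/
def negPos {l m : ℕ} (β : OneFactor l m) : Finset (Fin l) :=
  Finset.univ.filter fun i => β.entry i = -1

/-- `s_i(β) = β_1 + ⋯ + β_{i-1}`, for a position `i`. -/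
def sBefore {l m : ℕ} (β : OneFactor l m) (i : Fin l) : ℤ :=
  ∑ j ∈ Finset.Iio i, (β.entry j : ℤ)

/-- `s'_i(α, β)` is `-s_i` if `α_i = 1`, and `s_i + 1` if `α_i = -1`. -/
def sPrime {l m : ℕ} (α β : OneFactor l m) (i : Fin l) : ℤ :=
  if α.entry i = 1 then -sBefore β i else sBefore β i + 1

/-- The orthogonal maximal vector of a 1-factor. -/
def omax {k : Type*} [Field k] (v : k) {l m : ℕ} (α : OneFactor l m) : Tens k :=
  omaxWord v (List.ofFn α.entry)

/-- The maximal vector given by the link diagram of a 1-factor. -/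
def natMax {k : Type*} [Field k] (v : k) {l m : ℕ} (α : OneFactor l m) : Tens k :=
  natWord v (List.ofFn α.entry)

/-- `π` is a matrix of transition coefficients: `N(α) = ∑_β π_{α,β} ω(β)`, where `β` runs
over the 1-factors of the same shape as `α`. -/
def IsTransition {k : Type*} [Field k] (v : k) {l m : ℕ}
    (π : OneFactor l m → OneFactor l m → k) : Prop :=
  ∀ α, natMax v α = ∑ β, π α β • omax v β

end OrthTL

end

open OrthTL

noncomputable section

namespace OrthTL

variable {k : Type*} [Field k]

/-! ### Identities of quantum integers -/

/-! The diagram vector is expanded by splitting every link into its two orientations. If `t` is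
invariant, that is `K⁻¹ t = t` and `F t = 0`, then `b ⊗ Ψ(t) = [s+1]⁻¹ (Φ_2(Φ_1(b) ⊗ t) - Φ_1(Φ_2(b)
⊗ t))`, with the outer `Φ_2` taken at `s + 1` and the inner one at `s` (`mul_Psi`); closed diagrams
are invariant (`natWord_closed`). For `b` maximal of weight `s`, the vectors `Φ_1(b)` and, if `s >
0`, `Φ_2(b)` are again maximal, of weights `s ± 1`, so the diagram inside the link can be expanded
after them by induction. Hence `b ⊗ N(w)` is a sum over the words got from `w` by reversing links.
Orientation `(1,-1)` has its `-1` at the closing end, where `s_j = s + 1`, and contributes `1/[s+1]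
= [s_j+1]/([s_j][s_j+1])`. Orientation `(-1,1)` has it at the opening end, where `s_j = s`, and
contributes `-1/[s+1] = [-s_j]/([s_j][s_j+1])`. If `s = 0` then `Φ_2(b) = 0`, so words with a
negative partial sum drop out. This is the product formula (`mul_natWord_nesting`,
`exists_expansion`).

Factors of the same shape have the same total. With compatibility this forces all defects to stay
`1`, so a compatible factor is a link reversal (`FactorWord.wordCompat`) and lies below the given
one (`WordCompat.height_le`).

Uniqueness and the quotient formula come from orthogonality. The adjoint `E` of `F` satisfies `E F =
v² F E + v^(1-s)[s]` on weight `s` (`actE_actF`). Hence on maximal vectors `Φ_1` and `Φ_2` have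
orthogonal images, `Φ_1` is isometric, and `Φ_2` multiplies the form by `v[s][s+1]`. Recursion on
the last letter makes the `ω(β)` orthogonal, with nonzero norms because all quantum integers
involved divide `[n]!`. -/

theorem qnat_zero (v : k) : qnat v 0 = 0 := by simp [qnat]

theorem qnat_one (v : k) : qnat v 1 = 1 := by simp [qnat]

theorem qnat_succ {v : k} (hv : v ≠ 0) (n : ℕ) :
    qnat v (n + 1) = v ^ (n : ℤ) + v⁻¹ * qnat v n := by
  rw [qnat, Finset.sum_range_succ, qnat, Finset.mul_sum, add_comm]
  congr 1
  · congr 1; push_cast; ring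
  · refine Finset.sum_congr rfl fun t _ => ?_
    rw [← zpow_neg_one, ← zpow_add₀ hv]
    congr 1; push_cast; ring

theorem qnat_succ' {v : k} (hv : v ≠ 0) (n : ℕ) :
    qnat v (n + 1) = v ^ (-(n : ℤ)) + v * qnat v n := by
  rw [qnat, Finset.sum_range_succ', qnat, Finset.mul_sum, add_comm]
  congr 1
  · congr 1; push_cast; ring
  · refine Finset.sum_congr rfl fun t _ => ?_
    rw [← zpow_one_add₀ hv]
    congr 1; push_cast; ring

theorem qint_natCast (v : k) (n : ℕ) : qint v (n : ℤ) = qnat v n := rfl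

theorem qint_neg (v : k) (s : ℤ) : qint v (-s) = -qint v s := by
  rcases s with s | s
  · rcases s with _ | s
    · change qnat v 0 = -qnat v 0
      simp [qnat_zero]
    · rfl
  · change qnat v (s + 1) = - -qnat v (s + 1)
    simp

theorem qint_zero (v : k) : qint v 0 = 0 := qnat_zero v

theorem qint_one (v : k) : qint v 1 = 1 := qnat_one v

/-- Splitting the largest power off the sum gives this for `s ≥ 0`; for negative `s` it is the
mirror recursion, which splits off the smallest power. -/
theorem qint_add_one {v : k} (hv : v ≠ 0) (s : ℤ) :
    qint v (s + 1) = v ^ s + v⁻¹ * qint v s := by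
  obtain ⟨m, rfl | rfl⟩ := s.eq_nat_or_neg
  · exact qnat_succ hv m
  · rcases m with _ | m
    · simp [qint_zero, qint_one]
    · have h : -((m + 1 : ℕ) : ℤ) + 1 = -(m : ℤ) := by push_cast; ring
      rw [h, qint_neg, qint_neg, qint_natCast, qint_natCast, qnat_succ' hv]
      have h2 : v ^ (-((m + 1 : ℕ) : ℤ)) = v⁻¹ * v ^ (-(m : ℤ)) := by
        rw [← zpow_neg_one, ← zpow_add₀ hv]; congr 1; push_cast; ring
      rw [h2]
      field_simp
      ring

theorem qnat_ne_zero {v : k} {n : ℕ} (hn : qfact v n ≠ 0) {r : ℕ} (h1 : 0 < r) (h2 : r ≤ n) :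
    qnat v r ≠ 0 := by
  have h := Finset.prod_ne_zero_iff.mp hn (r - 1) (by simp; omega)
  rwa [Nat.sub_add_cancel h1] at h

theorem qint_ne_zero {v : k} {n : ℕ} (hn : qfact v n ≠ 0) {s : ℤ} (h1 : 0 < s) (h2 : s ≤ n) :
    qint v s ≠ 0 := by
  lift s to ℕ using h1.le
  exact qnat_ne_zero hn (by omega) (by omega)

/-! ### Tensor space -/

theorem tens_induction {P : Tens k → Prop} (one : P 1)
    (mul : ∀ x a, P x → P (x * yTens k a)) (add : ∀ x y, P x → P y → P (x + y))
    (smul : ∀ (c : k) x, P x → P (c • x)) (x : Tens k) : P x := by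
  -- Strengthening to an arbitrary left factor `z` makes the product case a composition of the two
  -- hypotheses.
  suffices h : ∀ z, P z → P (z * x) by simpa using h 1 one
  induction x using TensorAlgebra.induction with
  | algebraMap r =>
    intro z hz
    rw [← Algebra.commutes, ← Algebra.smul_def]
    exact smul r z hz
  | ι x =>
    intro z hz
    have hx : TensorAlgebra.ι k x = x 1 • yTens k 1 + x (-1) • yTens k (-1) := by
      simp only [yTens]
      rw [← LinearMap.map_smul, ← LinearMap.map_smul, ← LinearMap.map_add]
      congr 1
      ext a
      rcases Int.units_eq_one_or a with rfl | rfl <;> simp [yBasis]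
    rw [hx, mul_add, mul_smul_comm, mul_smul_comm]
    exact add _ _ (smul _ _ (mul _ _ hz)) (smul _ _ (mul _ _ hz))
  | mul a b ha hb =>
    intro z hz
    rw [← mul_assoc]
    exact hb _ (ha z hz)
  | add a b ha hb =>
    intro z hz
    rw [mul_add]
    exact add _ _ (ha z hz) (hb z hz)

theorem Phi1_def (b : Tens k) : Phi1 b = b * yTens k 1 := rfl

theorem actF_add (v : k) (x y : Tens k) : actF v (x + y) = actF v x + actF v y := by
  simp [actF]

theorem actF_smul (v c : k) (x : Tens k) : actF v (c • x) = c • actF v x := by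
  simp [actF]

theorem actF_zero (v : k) : actF v (0 : Tens k) = 0 := by
  simp [actF]

theorem actF_sub (v : k) (x y : Tens k) : actF v (x - y) = actF v x - actF v y := by
  simp [actF]

theorem actF_y_one (v : k) : actF v (yTens k 1) = yTens k (-1) := by
  rw [yTens, actF_ι, FV, Module.Basis.constr_basis]
  simp [yTens]

theorem actF_y_neg (v : k) : actF v (yTens k (-1)) = 0 := by
  rw [yTens, actF_ι, FV, Module.Basis.constr_basis]
  have h : (-1 : ℤˣ) ≠ 1 := by decide
  simp [h]

theorem Kinv_y (v : k) (a : ℤˣ) : Kinv v (yTens k a) = v ^ (-(a : ℤ)) • yTens k a := by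
  rw [Kinv, yTens, TensorAlgebra.lift_ι_apply, LinearMap.comp_apply, KinvV,
    Module.Basis.constr_basis, LinearMap.map_smul]

theorem Kinv_y_one (v : k) : Kinv v (yTens k 1) = v⁻¹ • yTens k 1 := by
  simp [Kinv_y]

theorem Kinv_y_neg (v : k) : Kinv v (yTens k (-1)) = v • yTens k (-1) := by
  simp [Kinv_y]

theorem actF_mul_y_one (v : k) (x : Tens k) :
    actF v (x * yTens k 1) = v⁻¹ • (actF v x * yTens k 1) + x * yTens k (-1) := by
  rw [actF_mul, Kinv_y_one, actF_y_one, mul_smul_comm]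

theorem actF_mul_y_neg (v : k) (x : Tens k) :
    actF v (x * yTens k (-1)) = v • (actF v x * yTens k (-1)) := by
  rw [actF_mul, Kinv_y_neg, actF_y_neg, mul_smul_comm, mul_zero, add_zero]

/-- The algebra automorphism of tensor space exchanging `y_1` and `y_{-1}`. -/
def swapT (k : Type*) [Field k] : Tens k →ₐ[k] Tens k :=
  TensorAlgebra.lift k ((TensorAlgebra.ι k).comp
    ((yBasis k).constr k fun ε => yBasis k (-ε)))

theorem swapT_y (a : ℤˣ) : swapT k (yTens k a) = yTens k (-a) := by
  rw [swapT, yTens, TensorAlgebra.lift_ι_apply, LinearMap.comp_apply, Module.Basis.constr_basis,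
    yTens]

theorem swapT_swapT (x : Tens k) : swapT k (swapT k x) = x := by
  induction x using tens_induction with
  | one => simp
  | mul x a h => simp [h, swapT_y]
  | add x y hx hy => simp [hx, hy]
  | smul c x h => simp [h]

/-- The adjoint of `F`: it maps `y_{-1}` to `y_1` and has the same coproduct as `F`. -/
def actE (v : k) (x : Tens k) : Tens k := swapT k (actF v⁻¹ (swapT k x))

theorem actE_one (v : k) : actE v (1 : Tens k) = 0 := by
  simp [actE, actF_one]

theorem actE_add (v : k) (x y : Tens k) : actE v (x + y) = actE v x + actE v y := by
  simp [actE, actF_add]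

theorem actE_smul (v c : k) (x : Tens k) : actE v (c • x) = c • actE v x := by
  simp [actE, actF_smul]

theorem actE_sub (v : k) (x y : Tens k) : actE v (x - y) = actE v x - actE v y := by
  simp [actE, actF_sub]

theorem actE_zero (v : k) : actE v (0 : Tens k) = 0 := by
  simp [actE, actF_zero]

/-- Exchanging `y_1` and `y_{-1}` inverts the eigenvalues of `K⁻¹`; the parameter `v⁻¹` in `actE`
compensates, so the right factor is twisted exactly as for `F`. -/
theorem actE_mul_y_one (v : k) (x : Tens k) :
    actE v (x * yTens k 1) = v⁻¹ • (actE v x * yTens k 1) := by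
  simp [actE, swapT_y, actF_mul_y_neg]

theorem actE_mul_y_neg (v : k) (x : Tens k) :
    actE v (x * yTens k (-1)) = v • (actE v x * yTens k (-1)) + x * yTens k 1 := by
  simp [actE, swapT_y, actF_mul_y_one, swapT_swapT]

/-! ### Weights -/

/-- `x` is of weight `s`. -/
inductive HasWt : ℤ → Tens k → Prop
  | zero (s) : HasWt s 0
  | one : HasWt 0 1
  | mul {s x} (a : ℤˣ) : HasWt s x → HasWt (s + a) (x * yTens k a)
  | add {s x y} : HasWt s x → HasWt s y → HasWt s (x + y)
  | smul {s x} (c : k) : HasWt s x → HasWt s (c • x)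

theorem HasWt.sub {s : ℤ} {x y : Tens k} (hx : HasWt s x) (hy : HasWt s y) :
    HasWt s (x - y) := by
  have h := hx.add (hy.smul (-1))
  rwa [neg_one_smul, ← sub_eq_add_neg] at h

theorem HasWt.mul_y {s t : ℤ} {x : Tens k} (hx : HasWt s x) (a : ℤˣ) (h : t = s + a) :
    HasWt t (x * yTens k a) := h ▸ hx.mul a

theorem HasWt.actF {v : k} {s : ℤ} {x : Tens k} (hx : HasWt s x) :
    HasWt (s - 2) (actF v x) := by
  induction hx with
  | zero s => rw [actF_zero]; exact .zero _
  | one => rw [actF_one]; exact .zero _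
  | @mul s x a hx h =>
    rcases Int.units_eq_one_or a with rfl | rfl
    · rw [actF_mul_y_one]
      exact ((h.mul_y 1 (by push_cast; ring)).smul _).add (hx.mul_y (-1) (by push_cast; ring))
    · rw [actF_mul_y_neg]
      exact (h.mul_y (-1) (by push_cast; ring)).smul _
  | add _ _ hx hy => rw [actF_add]; exact hx.add hy
  | smul c _ hx => rw [actF_smul]; exact hx.smul c

/-- The commutation relation of the quantum group, normalised for the adjoint. Induction on the last
tensor factor: the mixed terms cancel, and the scalar obeys the recursion `hq` in each case. -/
theorem actE_actF {v : k} (hv : v ≠ 0) {s : ℤ} {x : Tens k} (hx : HasWt s x) :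
    actE v (actF v x) = v ^ 2 • actF v (actE v x) + (v ^ (1 - s) * qint v s) • x := by
  induction hx with
  | zero s => simp [actF_zero, actE_zero]
  | one => simp [actF_one, actE_one, actE_zero, actF_zero, qint_zero]
  | @mul s x a hx h =>
    rcases Int.units_eq_one_or a with rfl | rfl
    · have hq : v ^ (1 - (s + ((1 : ℤˣ) : ℤ))) * qint v (s + ((1 : ℤˣ) : ℤ)) =
          v⁻¹ ^ 2 * (v ^ (1 - s) * qint v s) + 1 := by
        rw [Units.val_one, qint_add_one hv, show 1 - (s + 1) = -s by ring, zpow_sub₀ hv,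
          zpow_neg, zpow_one]
        have := zpow_ne_zero s hv
        field_simp
        ring
      rw [hq]
      simp only [actF_mul_y_one, actE_mul_y_one, actE_mul_y_neg, actE_add, actE_smul, h, actF_smul,
        add_mul, smul_add, smul_mul_assoc, smul_smul, add_smul, one_smul]
      have e1 : v⁻¹ * (v⁻¹ * v ^ 2) = v ^ 2 * (v⁻¹ * v⁻¹) := by ring
      have e2 : v ^ 2 * v⁻¹ = v := by field_simp
      have e3 : v⁻¹ * (v⁻¹ * (v ^ (1 - s) * qint v s)) = v⁻¹ ^ 2 * (v ^ (1 - s) * qint v s) := by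
        ring
      rw [e1, e2, e3]
      abel
    · have hq : v ^ (1 - (s + ((-1 : ℤˣ) : ℤ))) * qint v (s + ((-1 : ℤˣ) : ℤ)) =
          v ^ 2 * (v ^ (1 - s) * qint v s) - v ^ 2 := by
        obtain ⟨t, rfl⟩ : ∃ t, s = t + 1 := ⟨s - 1, by ring⟩
        rw [Units.val_neg, Units.val_one, add_neg_cancel_right, qint_add_one hv,
          show 1 - (t + 1) = -t by ring, zpow_sub₀ hv, zpow_neg, zpow_one]
        have := zpow_ne_zero t hv
        field_simp
        ring
      rw [hq]
      simp only [actF_mul_y_neg, actF_mul_y_one, actE_mul_y_neg, actF_add, actE_smul, h,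
        actF_smul, add_mul, smul_add, smul_mul_assoc, smul_smul, sub_smul]
      have e2 : v ^ 2 * v⁻¹ = v := by field_simp
      have e1 : v * (v * v ^ 2) = v ^ 2 * (v * v) := by ring
      have e3 : v * (v * (v ^ (1 - s) * qint v s)) = v ^ 2 * (v ^ (1 - s) * qint v s) := by ring
      rw [e1, e2, e3]
      abel
  | add _ _ hx hy =>
    simp only [actF_add, actE_add, hx, hy, smul_add]
    abel
  | smul c _ hx =>
    simp only [actF_smul, actE_smul, hx, smul_add, smul_smul, mul_comm c]

/-! ### The bilinear form -/

theorem form_add_left (x x' z : Tens k) : form (x + x') z = form x z + form x' z := by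
  simp only [form, map_add]
  exact Finsupp.sum_add_index' (by simp) (by intros; ring)

theorem form_smul_left (c : k) (x z : Tens k) : form (c • x) z = c * form x z := by
  simp only [form, map_smul]
  rw [Finsupp.sum_smul_index (by simp), Finsupp.mul_sum]
  simp only [mul_assoc]

theorem form_add_right (x z z' : Tens k) : form x (z + z') = form x z + form x z' := by
  simp only [form, map_add, Finsupp.add_apply, mul_add]
  exact Finsupp.sum_add

theorem form_smul_right (c : k) (x z : Tens k) : form x (c • z) = c * form x z := by
  simp only [form, map_smul, Finsupp.smul_apply, smul_eq_mul, Finsupp.mul_sum]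
  simp only [mul_left_comm]

theorem form_zero_left (z : Tens k) : form 0 z = 0 := by simp [form]

theorem form_zero_right (z : Tens k) : form z 0 = 0 := by simp [form]

theorem form_sub_left (x x' z : Tens k) : form (x - x') z = form x z - form x' z := by
  rw [sub_eq_add_neg, ← neg_one_smul k x', form_add_left, form_smul_left]; ring

theorem form_sub_right (x z z' : Tens k) : form x (z - z') = form x z - form x z' := by
  rw [sub_eq_add_neg, ← neg_one_smul k z', form_add_right, form_smul_right]; ring

theorem form_sum_left {ι : Type*} (s : Finset ι) (f : ι → Tens k) (z : Tens k) :
    form (∑ i ∈ s, f i) z = ∑ i ∈ s, form (f i) z := by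
  classical
  induction s using Finset.induction_on with
  | empty => simp [form_zero_left]
  | insert a s ha h => rw [Finset.sum_insert ha, Finset.sum_insert ha, form_add_left, h]

/-- The pure tensors of basis vectors span, so identities for the form reduce to `form_basis`. -/
theorem word_induction {P : Tens k → Prop} (word : ∀ w : List ℤˣ, P (w.map (yTens k)).prod)
    (add : ∀ x y, P x → P y → P (x + y)) (smul : ∀ (c : k) x, P x → P (c • x)) (x : Tens k) :
    P x := by
  have h : x ∈ Submodule.span k (Set.range fun w : List ℤˣ => (w.map (yTens k)).prod) := by
    induction x using tens_induction with
    | one => exact Submodule.subset_span ⟨[], rfl⟩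
    | mul x a hx =>
      induction hx using Submodule.span_induction with
      | mem x hx =>
        obtain ⟨w, rfl⟩ := hx
        exact Submodule.subset_span ⟨w ++ [a], by simp⟩
      | zero => simp
      | add x y _ _ hx hy => rw [add_mul]; exact Submodule.add_mem _ hx hy
      | smul c x _ hx => rw [smul_mul_assoc]; exact Submodule.smul_mem _ c hx
    | add x y hx hy => exact Submodule.add_mem _ hx hy
    | smul c x hx => exact Submodule.smul_mem _ c hx
  induction h using Submodule.span_induction with
  | mem x hx => obtain ⟨w, rfl⟩ := hx; exact word w
  | zero => simpa using smul 0 _ (word [])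
  | add x y _ _ hx hy => exact add _ _ hx hy
  | smul c x _ hx => exact smul c _ hx

theorem form_mul_y (a b : ℤˣ) (x z : Tens k) :
    form (x * yTens k a) (z * yTens k b) = if a = b then form x z else 0 := by
  induction x using word_induction with
  | word w =>
    induction z using word_induction with
    | word w' =>
      have h := form_basis (k := k) (w ++ [a]) (w' ++ [b])
      simp only [List.map_append, List.map_cons, List.map_nil, List.prod_append,
        List.prod_singleton] at h
      have hw : w ++ [a] = w' ++ [b] ↔ a = b ∧ w = w' := by
        rw [← List.concat_eq_append, ← List.concat_eq_append, List.concat_inj, and_comm]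
      rw [h, form_basis, ← ite_and]
      simp only [hw]
    | add x y hx hy => rw [add_mul, form_add_right, hx, hy, form_add_right]; split_ifs <;> simp
    | smul c x hx => rw [smul_mul_assoc, form_smul_right, hx, form_smul_right]; split_ifs <;> simp
  | add x y hx hy => rw [add_mul, form_add_left, hx, hy, form_add_left]; split_ifs <;> simp
  | smul c x hx => rw [smul_mul_assoc, form_smul_left, hx, form_smul_left]; split_ifs <;> simp

theorem form_one_mul_y (a : ℤˣ) (z : Tens k) : form 1 (z * yTens k a) = 0 := by
  induction z using word_induction with
  | word w => simpa using form_basis (k := k) [] (w ++ [a])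
  | add x y hx hy => rw [add_mul, form_add_right, hx, hy, add_zero]
  | smul c x hx => rw [smul_mul_assoc, form_smul_right, hx, mul_zero]

theorem form_mul_y_one (a : ℤˣ) (z : Tens k) : form (z * yTens k a) 1 = 0 := by
  induction z using word_induction with
  | word w => simpa using form_basis (k := k) (w ++ [a]) []
  | add x y hx hy => rw [add_mul, form_add_left, hx, hy, add_zero]
  | smul c x hx => rw [smul_mul_assoc, form_smul_left, hx, mul_zero]

theorem form_one_one : form (1 : Tens k) 1 = 1 := by
  simpa using form_basis (k := k) [] []

/-- Adjointness is checked by comparing last tensor factors: both operators have the same coproduct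
shape, `K⁻¹` is diagonal, and on `V` they are transposes. -/
theorem form_actF_right (v : k) (x z : Tens k) : form x (actF v z) = form (actE v x) z := by
  have h1 : (-1 : ℤˣ) ≠ 1 := by decide
  have h2 : (1 : ℤˣ) ≠ -1 := by decide
  induction x using tens_induction generalizing z with
  | one =>
    rw [actE_one, form_zero_left]
    induction z using tens_induction with
    | one => rw [actF_one, form_zero_right]
    | mul z a _ =>
      rcases Int.units_eq_one_or a with rfl | rfl
      · rw [actF_mul_y_one, form_add_right, form_smul_right, form_one_mul_y, form_one_mul_y]
        simp
      · rw [actF_mul_y_neg, form_smul_right, form_one_mul_y, mul_zero]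
    | add x y hx hy => rw [actF_add, form_add_right, hx, hy, add_zero]
    | smul c x hx => rw [actF_smul, form_smul_right, hx, mul_zero]
  | mul x b h =>
    induction z using tens_induction with
    | one =>
      rw [actF_one, form_zero_right]
      rcases Int.units_eq_one_or b with rfl | rfl
      · rw [actE_mul_y_one, form_smul_left, form_mul_y_one, mul_zero]
      · rw [actE_mul_y_neg, form_add_left, form_smul_left, form_mul_y_one, form_mul_y_one]
        simp
    | mul z a _ =>
      rcases Int.units_eq_one_or a with rfl | rfl <;> rcases Int.units_eq_one_or b with rfl | rfl
      all_goals simp [actF_mul_y_one, actF_mul_y_neg, actE_mul_y_one, actE_mul_y_neg,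
        form_add_left, form_add_right, form_smul_left, form_smul_right, form_mul_y, h, h1, h2]
    | add x y hx hy => rw [actF_add, form_add_right, hx, hy, form_add_right]
    | smul c x hx => rw [actF_smul, form_smul_right, hx, form_smul_right]
  | add x y hx hy => rw [form_add_left, hx, hy, actE_add, form_add_left]
  | smul c x hx => rw [form_smul_left, hx, actE_smul, form_smul_left]

/-! ### Highest weight vectors -/

theorem actF_iterate_mul_y_neg (v : k) (r : ℕ) (x : Tens k) :
    (actF v)^[r] (x * yTens k (-1)) = v ^ r • ((actF v)^[r] x * yTens k (-1)) := by
  induction r with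
  | zero => simp
  | succ r h =>
    rw [Function.iterate_succ_apply', h, actF_smul, actF_mul_y_neg, smul_smul, ← pow_succ,
      Function.iterate_succ_apply']

/-- A quantum binomial formula with two terms only, since `F²` vanishes on `V`. -/
theorem actF_iterate_mul_y_one {v : k} (hv : v ≠ 0) (r : ℕ) (x : Tens k) :
    (actF v)^[r + 1] (x * yTens k 1) = v⁻¹ ^ (r + 1) • ((actF v)^[r + 1] x * yTens k 1) +
      qnat v (r + 1) • ((actF v)^[r] x * yTens k (-1)) := by
  induction r with
  | zero => simp [actF_mul_y_one, qnat_one]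
  | succ r h =>
    rw [Function.iterate_succ_apply', h, actF_add, actF_smul, actF_smul, actF_mul_y_one,
      actF_mul_y_neg, qnat_succ' hv (r + 1), ← Function.iterate_succ_apply' (actF v),
      ← Function.iterate_succ_apply' (actF v), smul_add, smul_smul, ← pow_succ, smul_smul,
      add_smul, zpow_neg, zpow_natCast, ← inv_pow, mul_comm v, add_assoc]

theorem actF_iterate_smul (v c : k) (r : ℕ) (x : Tens k) :
    (actF v)^[r] (c • x) = c • (actF v)^[r] x := by
  induction r with
  | zero => rfl
  | succ r h => rw [Function.iterate_succ_apply', h, actF_smul, Function.iterate_succ_apply']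

theorem actF_iterate_sub (v : k) (r : ℕ) (x y : Tens k) :
    (actF v)^[r] (x - y) = (actF v)^[r] x - (actF v)^[r] y := by
  induction r with
  | zero => rfl
  | succ r h =>
    rw [Function.iterate_succ_apply', h, actF_sub, Function.iterate_succ_apply',
      Function.iterate_succ_apply']

/-- `b` is a maximal vector of weight `s ≥ 0`, killed by `F ^ (s + 1)`. -/
structure IsHighest (v : k) (s : ℤ) (b : Tens k) : Prop where
  nonneg : 0 ≤ s
  hasWt : HasWt s b
  actE_eq : actE v b = 0
  iterate_eq : (actF v)^[s.toNat + 1] b = 0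

theorem IsHighest.one (v : k) : IsHighest v 0 (1 : Tens k) :=
  ⟨le_rfl, .one, actE_one v, by simp [actF_one]⟩

theorem IsHighest.Phi1 {v : k} (hv : v ≠ 0) {s : ℤ} {b : Tens k} (hb : IsHighest v s b) :
    IsHighest v (s + 1) (Phi1 b) := by
  have h0 := hb.nonneg
  refine ⟨by omega, hb.hasWt.mul_y 1 (by simp), ?_, ?_⟩
  · rw [Phi1_def, actE_mul_y_one, hb.actE_eq, zero_mul, smul_zero]
  · rw [show (s + 1).toNat = s.toNat + 1 by omega, Phi1_def, actF_iterate_mul_y_one hv,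
      Function.iterate_succ_apply', hb.iterate_eq, actF_zero]
    simp

/-- The two coefficients in `Φ_2` are chosen so that `E` cancels: `[s] - v^(s-1) · v^(1-s)[s] = 0`.
For the power of `F`, the `y_1` part contains `F^(s+1) b = 0` and the two `y_{-1}` parts are equal.
-/
theorem IsHighest.Phi2 {v : k} (hv : v ≠ 0) {s : ℤ} {b : Tens k} (hs : 0 < s)
    (hb : IsHighest v s b) : IsHighest v (s - 1) (Phi2 v s b) := by
  refine ⟨by omega, ?_, ?_, ?_⟩
  · exact ((hb.hasWt.mul_y (-1) (by push_cast; ring)).smul _).sub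
      ((hb.hasWt.actF.mul_y 1 (by push_cast; ring)).smul _)
  · rw [OrthTL.Phi2, actE_sub, actE_smul, actE_smul, actE_mul_y_one, actE_mul_y_neg,
      actE_actF hv hb.hasWt, hb.actE_eq, actF_zero, zero_mul, smul_zero, smul_zero, zero_add,
      zero_add, smul_mul_assoc, smul_smul, smul_smul, ← sub_smul, zpow_sub₀ hv, zpow_one]
    have := zpow_ne_zero s hv
    have h : qint v s - v ^ s * v⁻¹ * (v / v ^ s * qint v s) = 0 := by field_simp; ring
    rw [h, zero_smul]
  · lift s to ℕ using hs.le
    obtain ⟨r, rfl⟩ : ∃ r, s = r + 1 := ⟨s - 1, by omega⟩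
    have h := hb.iterate_eq
    simp only [Int.toNat_natCast] at h
    rw [show ((r + 1 : ℕ) - 1 : ℤ).toNat = r by omega, OrthTL.Phi2, actF_iterate_sub,
      actF_iterate_smul, actF_iterate_smul, actF_iterate_mul_y_neg, actF_iterate_mul_y_one hv,
      ← Function.iterate_succ_apply (actF v), ← Function.iterate_succ_apply (actF v), h, zero_mul,
      smul_zero, zero_add, smul_smul, smul_smul, qint_natCast, zpow_natCast, mul_comm, sub_self]

/-- This is where nilpotency of `F` is needed: at weight `0` it says `F b = 0`. It makes steps below
height zero disappear from the expansion. -/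
theorem Phi2_zero_eq {v : k} {b : Tens k} (hb : IsHighest v 0 b) : Phi2 v 0 b = 0 := by
  have h := hb.iterate_eq
  simp only [Int.toNat_zero, zero_add, Function.iterate_one] at h
  simp [Phi2, qint_zero, h]

theorem form_Phi1_Phi1 (b c : Tens k) : form (Phi1 b) (Phi1 c) = form b c := by
  simp [Phi1_def, form_mul_y]

/-- Only the `y_1` component of `Φ_2(c)` meets `Φ_1(b)`; it is a multiple of `F c`, and moving `F`
across the form gives `E b = 0`. -/
theorem form_Phi1_Phi2 {v : k} {b c : Tens k} (s : ℤ) (hb : actE v b = 0) :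
    form (Phi1 b) (Phi2 v s c) = 0 := by
  have h2 : (1 : ℤˣ) ≠ -1 := by decide
  simp [Phi1_def, Phi2, form_sub_right, form_smul_right, form_mul_y, form_actF_right, hb,
    form_zero_left, h2]

theorem form_comm (x z : Tens k) : form x z = form z x := by
  induction x using word_induction with
  | word w =>
    induction z using word_induction with
    | word w' => rw [form_basis, form_basis]; simp only [eq_comm]
    | add x y hx hy => rw [form_add_right, form_add_left, hx, hy]
    | smul c x hx => rw [form_smul_right, form_smul_left, hx]
  | add x y hx hy => rw [form_add_right, form_add_left, hx, hy]
  | smul c x hx => rw [form_smul_right, form_smul_left, hx]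

/-- The two components contribute `[s]²` and `v^(2s) · v^(1-s)[s]`, and `[s] + v^(s+1) = v[s+1]`. -/
theorem form_Phi2_Phi2 {v : k} (hv : v ≠ 0) {s : ℤ} {b c : Tens k} (hb : IsHighest v s b) :
    form (Phi2 v s b) (Phi2 v s c) = v * (qint v s * qint v (s + 1)) * form b c := by
  have h1 : (-1 : ℤˣ) ≠ 1 := by decide
  have h2 : (1 : ℤˣ) ≠ -1 := by decide
  have := zpow_ne_zero s hv
  simp only [Phi2, form_sub_left, form_sub_right, form_smul_left, form_smul_right, form_mul_y,
    form_actF_right, actE_actF hv hb.hasWt, hb.actE_eq, actF_zero, h1, h2, if_true, if_false,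
    smul_zero, zero_add, qint_add_one hv, zpow_sub₀ hv, zpow_one]
  field_simp
  ring

/-! ### Invariants and nesting -/

theorem Psi_eq {v : k} {t : Tens k} (hK : Kinv v t = t) (hF : actF v t = 0) :
    Psi v t = yTens k 1 * t * yTens k (-1) - v • (yTens k (-1) * t * yTens k 1) := by
  rw [Psi, Phi2, qint_one, one_smul, zpow_one, actF_mul, hK, hF, actF_y_one, mul_zero, add_zero]

theorem actF_Psi {v : k} {t : Tens k} (hK : Kinv v t = t) (hF : actF v t = 0) :
    actF v (Psi v t) = 0 := by
  rw [Psi_eq hK hF, actF_sub, actF_smul, actF_mul_y_neg, actF_mul_y_one, actF_mul, actF_mul, hK,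
    hF, actF_y_one, actF_y_neg]
  simp

theorem Kinv_Psi {v : k} (hv : v ≠ 0) {t : Tens k} (hK : Kinv v t = t) (hF : actF v t = 0) :
    Kinv v (Psi v t) = Psi v t := by
  rw [Psi_eq hK hF]
  simp [Kinv_y_one, Kinv_y_neg, hK, smul_smul, hv]

theorem natWord_closed {v : k} (hv : v ≠ 0) {w : List ℤˣ} (hw : ClosedWord w) :
    Kinv v (natWord v w) = natWord v w ∧ actF v (natWord v w) = 0 := by
  induction hw with
  | nil => simp [natWord_nil, actF_one]
  | link hw he h1 h2 =>
    rw [natWord_link v _ he, map_mul, Kinv_Psi hv h2.1 h2.2, actF_mul, actF_Psi h2.1 h2.2,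
      h1.1, h1.2]
    simp

/-- The identity that resolves a link. Since `t` is invariant, `F` passes over it; the terms with `F
b` cancel, and the coefficient of `b ⊗ y_{-1} ⊗ t ⊗ y_1` is matched by `v[s+1] = v^(s+1) + [s]`.
Neither maximality nor the weight of `b` enters. -/
theorem mul_Psi {v : k} (hv : v ≠ 0) {t : Tens k} (hK : Kinv v t = t) (hF : actF v t = 0)
    {s : ℤ} (hs : qint v (s + 1) ≠ 0) (b : Tens k) :
    b * Psi v t = (qint v (s + 1))⁻¹ • (Phi2 v (s + 1) (Phi1 b * t) - Phi1 (Phi2 v s b * t)) := by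
  have h : actF v (Phi1 b * t) = (v⁻¹ • (actF v b * yTens k 1) + b * yTens k (-1)) * t := by
    rw [actF_mul, hK, hF, mul_zero, add_zero, Phi1_def, actF_mul_y_one]
  rw [eq_inv_smul_iff₀ hs, Psi_eq hK hF, Phi2, h]
  simp only [Phi1_def, Phi2, sub_mul, mul_sub, add_mul, smul_sub, smul_add, smul_mul_assoc,
    mul_smul_comm, smul_smul, mul_assoc]
  have e1 : v ^ (s + 1) * v⁻¹ = v ^ s := by rw [zpow_add_one₀ hv]; field_simp
  have e2 : qint v (s + 1) * v = v ^ (s + 1) + qint v s := by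
    rw [qint_add_one hv, zpow_add_one₀ hv]; field_simp
  rw [e1, e2, add_smul]
  abel

/-! ### Heights of words -/

/-- The sum of the letters of a word. -/
def psum (w : List ℤˣ) : ℤ := (w.map fun a => (a : ℤ)).sum

@[simp] theorem psum_nil : psum [] = 0 := rfl

@[simp] theorem psum_cons (a : ℤˣ) (w : List ℤˣ) : psum (a :: w) = a + psum w := by simp [psum]

@[simp] theorem psum_append (w w' : List ℤˣ) : psum (w ++ w') = psum w + psum w' := by
  simp [psum]

/-- The sum of the first `t` letters of a word. -/
def height (w : List ℤˣ) (t : ℕ) : ℤ := psum (w.take t)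

theorem height_zero (w : List ℤˣ) : height w 0 = 0 := by simp [height]

theorem height_length (w : List ℤˣ) : height w w.length = psum w := by simp [height]

theorem height_append_left (w e : List ℤˣ) {t : ℕ} (ht : t ≤ w.length) :
    height (w ++ e) t = height w t := by
  simp [height, List.take_append, Nat.sub_eq_zero_of_le ht]

theorem height_append_right (w e : List ℤˣ) (t : ℕ) :
    height (w ++ e) (w.length + t) = psum w + height e t := by
  rw [height, List.take_append, List.take_of_length_le (by omega), Nat.add_sub_cancel_left,
    psum_append, height]

theorem height_cons (a : ℤˣ) (e : List ℤˣ) (t : ℕ) :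
    height (a :: e) (t + 1) = a + height e t := by
  simp [height]

theorem height_link_mid (w e : List ℤˣ) (a b : ℤˣ) {t : ℕ} (ht : t ≤ e.length) :
    height (w ++ a :: (e ++ [b])) (w.length + 1 + t) = psum w + a + height e t := by
  rw [add_assoc, height_append_right, add_comm 1, height_cons, height_append_left _ _ ht]
  ring

theorem height_link_end (w e : List ℤˣ) (a b : ℤˣ) :
    height (w ++ a :: (e ++ [b])) (w.length + 1 + e.length + 1) = psum w + a + psum e + b := by
  have h := height_length (w ++ a :: (e ++ [b]))
  simp only [List.length_append, List.length_cons, List.length_nil, psum_append, psum_cons,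
    psum_nil] at h
  rw [show w.length + 1 + e.length + 1 = w.length + (e.length + (0 + 1) + 1) by ring, h]
  ring

/-- All partial sums are nonnegative. -/
def NonnegWord (w : List ℤˣ) : Prop := ∀ t, 0 ≤ height w t

theorem NonnegWord.psum_nonneg {w : List ℤˣ} (h : NonnegWord w) : 0 ≤ psum w :=
  height_length w ▸ h w.length

theorem NonnegWord.left {w e : List ℤˣ} (h : NonnegWord (w ++ e)) : NonnegWord w := by
  intro t
  rcases le_total t w.length with ht | ht
  · rw [← height_append_left w e ht]; exact h t
  · have h2 := h w.length
    rw [height_append_left w e le_rfl, height_length] at h2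
    rwa [height, List.take_of_length_le ht]

theorem ClosedWord.psum_eq {w : List ℤˣ} (h : ClosedWord w) : psum w = 0 := by
  induction h with
  | nil => rfl
  | link _ _ h1 h2 => simp [h1, h2]

/-- A juxtaposition of defects and nestings of closed words. -/
inductive FactorWord : List ℤˣ → Prop
  | nil : FactorWord []
  | defect {w : List ℤˣ} : FactorWord w → FactorWord (w ++ [1])
  | link {w e : List ℤˣ} : FactorWord w → ClosedWord e → FactorWord e →
      FactorWord (w ++ 1 :: (e ++ [-1]))

theorem ClosedWord.factorWord {w : List ℤˣ} (h : ClosedWord w) : FactorWord w := by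
  induction h with
  | nil => exact .nil
  | link _ he h1 h2 => exact .link h1 he h2

/-- The last unmatched `1` has a closed word to its right. If the word ends in `-1`, the prefix has
total at least `2`: its last unmatched `1` is the partner of that `-1`, and the one before it is the
letter sought. -/
theorem exists_last_unmatched (L : ℕ) (w : List ℤˣ) (hL : w.length ≤ L) (hw : NonnegWord w)
    (hs : 0 < psum w) : ∃ u e, w = u ++ 1 :: e ∧ ClosedWord e := by
  induction L generalizing w with
  | zero =>
    obtain rfl : w = [] := List.length_eq_zero_iff.mp (by omega)
    simp at hs
  | succ L ih =>
    rcases List.eq_nil_or_concat' w with rfl | ⟨x, a, rfl⟩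
    · simp at hs
    simp only [List.length_append, List.length_cons, List.length_nil] at hL
    rcases Int.units_eq_one_or a with rfl | rfl
    · exact ⟨x, [], rfl, .nil⟩
    · have hx := hw.left
      simp only [psum_append, psum_cons, Units.val_neg, Units.val_one, psum_nil] at hs
      obtain ⟨u, e, rfl, he⟩ := ih x (by omega) hx (by omega)
      simp only [List.length_append, List.length_cons, psum_append, psum_cons, Units.val_one,
        he.psum_eq] at hL hs
      obtain ⟨u', e', rfl, he'⟩ := ih u (by omega) hx.left (by omega)
      exact ⟨u', e' ++ 1 :: (e ++ [-1]), by simp, he'.link he⟩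

/-- A last letter `1` is a defect; a last letter `-1` closes a link with the last unmatched `1` of
the prefix. -/
theorem NonnegWord.factorWord {w : List ℤˣ} (hw : NonnegWord w) : FactorWord w := by
  induction h : w.length using Nat.strong_induction_on generalizing w with
  | _ L ih =>
    subst h
    rcases List.eq_nil_or_concat' w with rfl | ⟨x, a, rfl⟩
    · exact .nil
    rcases Int.units_eq_one_or a with rfl | rfl
    · exact .defect (ih x.length (by simp) hw.left rfl)
    · have h0 := hw.psum_nonneg
      simp only [psum_append, psum_cons, Units.val_neg, Units.val_one, psum_nil] at h0
      obtain ⟨u, e, rfl, he⟩ := exists_last_unmatched _ x le_rfl hw.left (by omega)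
      have h1 := ih u.length (by simp) hw.left.left rfl
      simpa using h1.link he he.factorWord

/-! ### Compatible words -/

/-- `w'` is obtained from a factor word `w` by reversing the signs of some of its links. -/
inductive WordCompat : List ℤˣ → List ℤˣ → Prop
  | nil : WordCompat [] []
  | defect {w w' : List ℤˣ} : WordCompat w w' → WordCompat (w ++ [1]) (w' ++ [1])
  | link {w w' e e' : List ℤˣ} (a : ℤˣ) : WordCompat w w' → ClosedWord e → WordCompat e e' →
      WordCompat (w ++ 1 :: (e ++ [-1])) (w' ++ a :: (e' ++ [-a]))

theorem WordCompat.length_eq {w w' : List ℤˣ} (h : WordCompat w w') : w'.length = w.length := by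
  induction h with
  | nil => rfl
  | defect _ h => simp [h]
  | link _ _ _ _ h1 h2 => simp [h1, h2]

theorem WordCompat.psum_eq {w w' : List ℤˣ} (h : WordCompat w w') : psum w' = psum w := by
  induction h with
  | nil => rfl
  | defect _ h => simp [h]
  | link _ _ _ _ h1 h2 => simp [h1, h2]

theorem height_le_natCast (w' : List ℤˣ) (t : ℕ) : height w' t ≤ t := by
  induction w' generalizing t with
  | nil => simp [height]
  | cons a w ih =>
    rcases t with _ | t
    · simp [height]
    · rw [height_cons]
      have := ih t
      rcases Int.units_eq_one_or a with rfl | rfl <;> push_cast <;> omega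

theorem psum_le_length (w : List ℤˣ) : psum w ≤ w.length :=
  height_length w ▸ height_le_natCast w w.length

/-- A compatible word lies below the given one. -/
theorem WordCompat.height_le {w w' : List ℤˣ} (h : WordCompat w w') (t : ℕ) :
    height w' t ≤ height w t := by
  induction h generalizing t with
  | nil => exact le_rfl
  | @defect w w' h ih =>
    rcases le_or_gt t w.length with ht | ht
    · rw [height_append_left _ _ ht, height_append_left _ _ (h.length_eq ▸ ht)]
      exact ih t
    · rw [height, height, List.take_of_length_le (by have := h.length_eq; simp; omega),
        List.take_of_length_le (by simp; omega)]
      simp [h.psum_eq]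
  | @link w w' e e' a h he h2 ih ih2 =>
    rcases le_or_gt t w.length with ht | ht
    · rw [height_append_left _ _ ht, height_append_left _ _ (h.length_eq ▸ ht)]
      exact ih t
    rcases le_or_gt t (w.length + 1 + e.length) with ht2 | ht2
    · obtain ⟨r, rfl⟩ := Nat.exists_eq_add_of_le ht
      have hr : r ≤ e.length := by omega
      have h3 := height_link_mid w' e' a (-a) (h2.length_eq ▸ hr)
      rw [h.length_eq] at h3
      rw [Nat.succ_eq_add_one, height_link_mid w e 1 (-1) hr, h3, h.psum_eq]
      have := ih2 r
      -- Reversing a link lowers all heights strictly inside it by `2` and leaves the height after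
      -- it unchanged.
      rcases Int.units_eq_one_or a with rfl | rfl <;> push_cast <;> omega
    · rw [height, height, List.take_of_length_le (by have := h.length_eq; have := h2.length_eq; simp; omega),
        List.take_of_length_le (by simp; omega)]
      simp [h.psum_eq, h2.psum_eq]

/-- The positions `i < j` of a word are paired. -/
structure PairedAt (w : List ℤˣ) (i j : ℕ) : Prop where
  lt : i < j
  lt_length : j < w.length
  height_eq : height w (j + 1) = height w i
  height_lt : ∀ t, i < t → t ≤ j → height w i < height w t

/-- `w'` has opposite letters at paired positions of `w`. -/
def CompatAt (w w' : List ℤˣ) : Prop :=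
  ∀ i j, PairedAt w i j → w'.getD i 1 = -w'.getD j 1

theorem ClosedWord.nonneg {w : List ℤˣ} (h : ClosedWord w) (t : ℕ) : 0 ≤ height w t := by
  induction h generalizing t with
  | nil => simp [height]
  | @link w e hw he ih1 ih2 =>
    rcases le_or_gt t w.length with ht | ht
    · rw [height_append_left _ _ ht]; exact ih1 t
    rcases le_or_gt t (w.length + 1 + e.length) with ht2 | ht2
    · obtain ⟨r, rfl⟩ := Nat.exists_eq_add_of_le ht
      rw [Nat.succ_eq_add_one, height_link_mid w e 1 (-1) (by omega), hw.psum_eq]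
      have := ih2 r
      push_cast; omega
    · rw [height, List.take_of_length_le (by simp; omega)]
      simp [hw.psum_eq, he.psum_eq]

theorem PairedAt.of_append {w e : List ℤˣ} {i j : ℕ} (h : PairedAt (w ++ e) i j)
    (hj : j < w.length) : PairedAt w i j := by
  obtain ⟨h1, h2, h3, h4⟩ := h
  refine ⟨h1, hj, ?_, fun t ht1 ht2 => ?_⟩
  · rwa [height_append_left _ _ (by omega), height_append_left _ _ (by omega)] at h3
  · have := h4 t ht1 ht2
    rwa [height_append_left _ _ (by omega), height_append_left _ _ (by omega)] at this

theorem PairedAt.append {w : List ℤˣ} (e : List ℤˣ) {i j : ℕ} (h : PairedAt w i j) :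
    PairedAt (w ++ e) i j := by
  obtain ⟨h1, h2, h3, h4⟩ := h
  refine ⟨h1, by simp; omega, ?_, fun t ht1 ht2 => ?_⟩
  · rwa [height_append_left _ _ (by omega), height_append_left _ _ (by omega)]
  · rw [height_append_left _ _ (by omega), height_append_left _ _ (by omega)]
    exact h4 t ht1 ht2

theorem pairedAt_link_mid (w e : List ℤˣ) (a b : ℤˣ) {i j : ℕ} (hj : j < e.length) :
    PairedAt (w ++ a :: (e ++ [b])) (w.length + 1 + i) (w.length + 1 + j) ↔ PairedAt e i j := by
  constructor
  · rintro ⟨h1, h2, h3, h4⟩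
    have hij : i < j := by omega
    refine ⟨hij, hj, ?_, fun t ht1 ht2 => ?_⟩
    · rw [add_assoc _ j, height_link_mid _ _ _ _ hj, height_link_mid _ _ _ _ (by omega)] at h3
      linarith
    · have := h4 (w.length + 1 + t) (by omega) (by omega)
      rw [height_link_mid _ _ _ _ (by omega), height_link_mid _ _ _ _ (by omega)] at this
      linarith
  · rintro ⟨h1, h2, h3, h4⟩
    refine ⟨by omega, by simp; omega, ?_, fun t ht1 ht2 => ?_⟩
    · rw [add_assoc _ j, height_link_mid _ _ _ _ hj, height_link_mid _ _ _ _ (by omega)]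
      linarith
    · obtain ⟨r, rfl⟩ := Nat.exists_eq_add_of_le (show w.length + 1 ≤ t by omega)
      have := h4 r (by omega) (by omega)
      rw [height_link_mid _ _ _ _ (by omega), height_link_mid _ _ _ _ (by omega)]
      linarith

theorem pairedAt_link_ends (w : List ℤˣ) {e : List ℤˣ} (he : ClosedWord e) :
    PairedAt (w ++ 1 :: (e ++ [-1])) w.length (w.length + 1 + e.length) := by
  have h0 : height (w ++ 1 :: (e ++ [-1])) w.length = psum w := by
    rw [height_append_left _ _ le_rfl, height_length]
  refine ⟨by omega, by simp; omega, ?_, fun t ht1 ht2 => ?_⟩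
  · rw [height_link_end, he.psum_eq, h0]
    simp
  · obtain ⟨r, rfl⟩ := Nat.exists_eq_add_of_le (show w.length + 1 ≤ t by omega)
    rw [h0, height_link_mid _ _ _ _ (by omega)]
    have := he.nonneg r
    push_cast; omega

/-- Between the two ends of the last link the height stays at least `psum w + 1`, and it returns to
`psum w` only at the end. So no pair can straddle an end of the link. -/
theorem pairedAt_link {w e : List ℤˣ} (he : ClosedWord e) {i j : ℕ}
    (h : PairedAt (w ++ 1 :: (e ++ [-1])) i j) :
    PairedAt w i j ∨ (i = w.length ∧ j = w.length + 1 + e.length) ∨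
      ∃ i' j', i = w.length + 1 + i' ∧ j = w.length + 1 + j' ∧ PairedAt e i' j' := by
  have h0 : height (w ++ 1 :: (e ++ [-1])) w.length = psum w := by
    rw [height_append_left _ _ le_rfl, height_length]
  have hmid : ∀ r ≤ e.length,
      psum w + 1 ≤ height (w ++ 1 :: (e ++ [-1])) (w.length + 1 + r) := by
    intro r hr
    rw [height_link_mid _ _ _ _ hr]
    have := he.nonneg r
    push_cast; omega
  have hend : height (w ++ 1 :: (e ++ [-1])) (w.length + 1 + e.length + 1) = psum w := by
    rw [height_link_end, he.psum_eq]
    simp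
  have hlen := h.lt_length
  have hlt := h.lt
  have heq := h.height_eq
  simp only [List.length_append, List.length_cons, List.length_nil] at hlen
  rcases lt_or_ge j w.length with hj | hj
  · exact .inl (h.of_append hj)
  have hj1 : j = w.length + 1 + e.length ∨
      psum w + 1 ≤ height (w ++ 1 :: (e ++ [-1])) (j + 1) := by
    by_cases hj2 : j = w.length + 1 + e.length
    · exact .inl hj2
    · obtain ⟨r, rfl⟩ := Nat.exists_eq_add_of_le hj
      right
      rw [add_right_comm]
      exact hmid r (by omega)
  rcases lt_trichotomy i w.length with hi | hi | hi
  · have h1 := h.height_lt _ hi hj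
    rw [h0] at h1
    rcases hj1 with rfl | hj1
    · rw [hend] at heq; omega
    · omega
  · subst hi
    rcases hj1 with rfl | hj1
    · exact .inr (.inl ⟨rfl, rfl⟩)
    · omega
  · obtain ⟨i', rfl⟩ := Nat.exists_eq_add_of_le (show w.length + 1 ≤ i by omega)
    obtain ⟨j', rfl⟩ := Nat.exists_eq_add_of_le (show w.length + 1 ≤ j by omega)
    have h1 := hmid i' (by omega)
    by_cases hj2 : j' = e.length
    · subst hj2
      rw [hend] at heq
      omega
    · exact .inr (.inr ⟨i', j', rfl, rfl, (pairedAt_link_mid w e 1 (-1) (by omega)).mp h⟩)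

theorem getD_link_mid (w e : List ℤˣ) (a b : ℤˣ) {i : ℕ} (hi : i < e.length) :
    (w ++ a :: (e ++ [b])).getD (w.length + 1 + i) 1 = e.getD i 1 := by
  rw [List.getD_append_right _ _ _ _ (by omega), add_assoc, Nat.add_sub_cancel_left, add_comm 1,
    List.getD_cons_succ, List.getD_append _ _ _ _ hi]

theorem getD_link_start (w e : List ℤˣ) (a b : ℤˣ) :
    (w ++ a :: (e ++ [b])).getD w.length 1 = a := by
  rw [List.getD_append_right _ _ _ _ le_rfl, Nat.sub_self, List.getD_cons_zero]

theorem getD_link_end (w e : List ℤˣ) (a b : ℤˣ) :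
    (w ++ a :: (e ++ [b])).getD (w.length + 1 + e.length) 1 = b := by
  rw [List.getD_append_right _ _ _ _ (by omega), add_assoc, Nat.add_sub_cancel_left, add_comm 1,
    List.getD_cons_succ, List.getD_append_right _ _ _ _ le_rfl, Nat.sub_self, List.getD_cons_zero]

theorem WordCompat.compatAt {w w' : List ℤˣ} (h : WordCompat w w') : CompatAt w w' := by
  induction h with
  | nil => intro i j hp; simpa using hp.lt_length
  | @defect w w' h ih =>
    intro i j hp
    rcases lt_or_ge j w.length with hj | hj
    · have hi := hp.lt
      rw [List.getD_append _ _ _ _ (by rw [h.length_eq]; omega),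
        List.getD_append _ _ _ _ (by rw [h.length_eq]; omega)]
      exact ih i j (hp.of_append hj)
    · have hlen := hp.lt_length
      simp only [List.length_append, List.length_cons, List.length_nil] at hlen
      obtain rfl : j = w.length := by omega
      have h1 := hp.height_lt _ hp.lt le_rfl
      have h2 := hp.height_eq
      have h3 := height_length (w ++ [1])
      simp only [List.length_append, List.length_cons, List.length_nil, psum_append, psum_cons,
        Units.val_one, psum_nil, zero_add, add_zero] at h3
      rw [h3] at h2
      rw [← h2, height_append_left _ _ le_rfl, height_length] at h1
      omega
  | @link w w' e e' a h he h2 ih ih2 =>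
    intro i j hp
    rcases pairedAt_link he hp with hq | ⟨rfl, rfl⟩ | ⟨i', j', rfl, rfl, hq⟩
    · have h3 := hq.lt
      have h4 := hq.lt_length
      rw [List.getD_append _ _ _ _ (by rw [h.length_eq]; omega),
        List.getD_append _ _ _ _ (by rw [h.length_eq]; omega)]
      exact ih i j hq
    · rw [← h.length_eq, ← h2.length_eq, getD_link_start, getD_link_end, neg_neg]
    · have h3 := hq.lt
      have h4 := hq.lt_length
      rw [← h.length_eq, getD_link_mid _ _ _ _ (by rw [h2.length_eq]; omega),
        getD_link_mid _ _ _ _ (by rw [h2.length_eq]; omega)]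
      exact ih2 i' j' hq

theorem CompatAt.of_append {w e w' e' : List ℤˣ} (hlen : w'.length = w.length)
    (hc : CompatAt (w ++ e) (w' ++ e')) : CompatAt w w' := by
  intro i j hp
  have h := hc i j (hp.append _)
  have h3 := hp.lt
  have h4 := hp.lt_length
  rwa [List.getD_append _ _ _ _ (by omega), List.getD_append _ _ _ _ (by omega)] at h

theorem CompatAt.exists_defect {w w' : List ℤˣ} (hlen : w'.length = (w ++ [1]).length)
    (hc : CompatAt (w ++ [1]) w') :
    ∃ u a, w' = u ++ [a] ∧ u.length = w.length ∧ CompatAt w u := by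
  rcases List.eq_nil_or_concat' w' with rfl | ⟨x, a, rfl⟩
  · simp at hlen
  have hx : x.length = w.length := by simpa using hlen
  exact ⟨x, a, rfl, hx, hc.of_append hx⟩

theorem CompatAt.exists_link {w e w' : List ℤˣ} (he : ClosedWord e)
    (hlen : w'.length = (w ++ 1 :: (e ++ [-1])).length)
    (hc : CompatAt (w ++ 1 :: (e ++ [-1])) w') :
    ∃ u a x, w' = u ++ a :: (x ++ [-a]) ∧ u.length = w.length ∧ x.length = e.length ∧
      CompatAt w u ∧ CompatAt e x := by
  obtain ⟨u, a, x, b, rfl, hu, hx⟩ : ∃ u a x b, w' = u ++ a :: (x ++ [b]) ∧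
      u.length = w.length ∧ x.length = e.length := by
    simp only [List.length_append, List.length_cons, List.length_nil] at hlen
    have h1 : (w'.drop w.length).length = e.length + 2 := by simp; omega
    rcases h3 : w'.drop w.length with _ | ⟨a, y⟩
    · rw [h3] at h1; simp at h1
    rcases List.eq_nil_or_concat' y with rfl | ⟨x, b, rfl⟩
    · rw [h3] at h1; simp at h1
    refine ⟨w'.take w.length, a, x, b, ?_, by simp; omega, ?_⟩
    · have := List.take_append_drop w.length w'
      rw [h3] at this
      exact this.symm
    · rw [h3] at h1; simpa using h1
  have hab := hc _ _ (pairedAt_link_ends w he)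
  rw [← hu, ← hx, getD_link_start, getD_link_end] at hab
  refine ⟨u, a, x, by rw [hab, neg_neg], hu, hx, hc.of_append hu, fun i j hp => ?_⟩
  have h3 := hp.lt
  have h4 := hp.lt_length
  have h := hc _ _ ((pairedAt_link_mid w e 1 (-1) hp.lt_length).mpr hp)
  rwa [← hu, getD_link_mid _ _ _ _ (by omega), getD_link_mid _ _ _ _ (by omega)] at h

/-- Paired letters of `w'` cancel, so its total is a sum of signs over the defects of `w`, whose
number is `psum w`. -/
theorem FactorWord.psum_le {w : List ℤˣ} (h : FactorWord w) {w' : List ℤˣ}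
    (hlen : w'.length = w.length) (hc : CompatAt w w') :
    psum w' ≤ psum w ∧ -psum w ≤ psum w' := by
  induction h generalizing w' with
  | nil =>
    obtain rfl := List.length_eq_zero_iff.mp hlen
    exact ⟨le_rfl, le_rfl⟩
  | @defect w h ih =>
    obtain ⟨u, a, rfl, hu, hc⟩ := hc.exists_defect hlen
    obtain ⟨h1, h2⟩ := ih hu hc
    rcases Int.units_eq_one_or a with rfl | rfl <;>
      simp only [psum_append, psum_cons, psum_nil, Units.val_one, Units.val_neg] <;> omega
  | @link w e h he h2 ih ih2 =>
    obtain ⟨u, a, x, rfl, hu, hx, hcu, hcx⟩ := hc.exists_link he hlen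
    obtain ⟨h3, h4⟩ := ih hu hcu
    obtain ⟨h5, h6⟩ := ih2 hx hcx
    rw [he.psum_eq] at h5 h6
    simp only [psum_append, psum_cons, psum_nil, Units.val_one, Units.val_neg, he.psum_eq]
    omega

/-- `CompatAt` does not constrain the letters at defects. Equality of totals is the extreme case of
`psum_le`, which forces all of them to be `1`. -/
theorem FactorWord.wordCompat {w : List ℤˣ} (h : FactorWord w) {w' : List ℤˣ}
    (hlen : w'.length = w.length) (hc : CompatAt w w') (hp : psum w' = psum w) :
    WordCompat w w' := by
  induction h generalizing w' with
  | nil =>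
    obtain rfl := List.length_eq_zero_iff.mp hlen
    exact .nil
  | @defect w h ih =>
    obtain ⟨u, a, rfl, hu, hcu⟩ := hc.exists_defect hlen
    have h1 := (h.psum_le hu hcu).1
    rcases Int.units_eq_one_or a with rfl | rfl <;>
      simp only [psum_append, psum_cons, psum_nil, Units.val_one, Units.val_neg] at hp
    · exact (ih hu hcu (by omega)).defect
    · omega
  | @link w e h he h2 ih ih2 =>
    obtain ⟨u, a, x, rfl, hu, hx, hcu, hcx⟩ := hc.exists_link he hlen
    have h3 := h2.psum_le hx hcx
    rw [he.psum_eq] at h3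
    simp only [psum_append, psum_cons, psum_nil, Units.val_one, Units.val_neg, he.psum_eq] at hp
    exact (ih hu hcu (by omega)).link a he (ih2 hx hcx (by rw [he.psum_eq]; omega))

/-! ### Transition coefficients on words -/

/-- The factor of a transition coefficient that belongs to one position, where the lower word has
partial sum `s` before that position. -/
def coefFactor (v : k) (s : ℤ) (a b : ℤˣ) : k :=
  if b = -1 then qint v (if a = 1 then -s else s + 1) / (qint v s * qint v (s + 1)) else 1

/-- The transition coefficient of two words, with initial partial sum `s`. -/
def coef (v : k) : ℤ → List ℤˣ → List ℤˣ → k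
  | s, a :: w, b :: w' => coefFactor v s a b * coef v (s + b) w w'
  | _, _, _ => 1

@[simp] theorem coef_nil (v : k) (s : ℤ) : coef v s [] [] = 1 := by simp [coef]

@[simp] theorem coef_cons (v : k) (s : ℤ) (a b : ℤˣ) (w w' : List ℤˣ) :
    coef v s (a :: w) (b :: w') = coefFactor v s a b * coef v (s + b) w w' := by simp [coef]

theorem coef_append (v : k) (s : ℤ) {w w' : List ℤˣ} (h : w'.length = w.length)
    (e e' : List ℤˣ) :
    coef v s (w ++ e) (w' ++ e') = coef v s w w' * coef v (s + psum w') e e' := by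
  induction w generalizing w' s with
  | nil =>
    obtain rfl := List.length_eq_zero_iff.mp h
    simp
  | cons a w ih =>
    rcases w' with _ | ⟨b, w'⟩
    · simp at h
    · simp only [List.cons_append, coef_cons, psum_cons]
      rw [ih _ (by simpa using h), mul_assoc, add_assoc]

theorem foldl_omaxStep_fst (v : k) (w : List ℤˣ) (s : ℤ) (b : Tens k) :
    (w.foldl (omaxStep v) (s, b)).1 = s + psum w := by
  induction w generalizing s b with
  | nil => simp
  | cons a w ih => rw [List.foldl_cons, omaxStep, ih, psum_cons, add_assoc]

theorem foldl_omaxStep_append (v : k) (w e : List ℤˣ) (s : ℤ) (b : Tens k) :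
    (w ++ e).foldl (omaxStep v) (s, b) =
      e.foldl (omaxStep v) (s + psum w, (w.foldl (omaxStep v) (s, b)).2) := by
  rw [List.foldl_append, ← foldl_omaxStep_fst v w s b]

theorem omaxStep_one (v : k) (s : ℤ) (b : Tens k) : omaxStep v (s, b) 1 = (s + 1, Phi1 b) := by
  simp [omaxStep]

theorem omaxStep_neg (v : k) (s : ℤ) (b : Tens k) :
    omaxStep v (s, b) (-1) = (s - 1, Phi2 v s b) := by
  have h : (-1 : ℤˣ) ≠ 1 := by decide
  simp [omaxStep, h, sub_eq_add_neg]

theorem IsHighest.foldl {v : k} (hv : v ≠ 0) {w : List ℤˣ} {s : ℤ} {b : Tens k}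
    (hb : IsHighest v s b) (hw : ∀ t, 0 ≤ s + height w t) :
    IsHighest v (s + psum w) (w.foldl (omaxStep v) (s, b)).2 := by
  induction w generalizing s b with
  | nil => simpa using hb
  | cons a w ih =>
    have hw' : ∀ t, 0 ≤ s + a + height w t := by
      intro t
      have := hw (t + 1)
      rwa [height_cons, ← add_assoc] at this
    have h0 := hw' 0
    rw [height_zero] at h0
    rw [psum_cons, ← add_assoc, List.foldl_cons]
    rcases Int.units_eq_one_or a with rfl | rfl
    · rw [omaxStep_one]
      exact ih (hb.Phi1 hv) hw'
    · rw [omaxStep_neg]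
      simp only [Units.val_neg, Units.val_one, add_zero, ← sub_eq_add_neg] at h0 hw' ⊢
      exact ih (hb.Phi2 hv (by omega)) hw'

/-- A step from height `0` to `-1` carries a factor with denominator `[0][1] = 0`, and division by
zero gives `0`. -/
theorem height_nonneg_of_coef_ne_zero {v : k} {w w' : List ℤˣ} {s : ℤ} (hs : 0 ≤ s)
    (hlen : w'.length = w.length) (hc : coef v s w w' ≠ 0) (t : ℕ) : 0 ≤ s + height w' t := by
  induction w generalizing w' s t with
  | nil =>
    obtain rfl := List.length_eq_zero_iff.mp hlen
    simpa [height] using hs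
  | cons a w ih =>
    rcases w' with _ | ⟨b, w'⟩
    · simp at hlen
    rcases t with _ | t
    · simpa [height] using hs
    rw [coef_cons] at hc
    rw [height_cons, ← add_assoc]
    refine ih ?_ (by simpa using hlen) (right_ne_zero_of_mul hc) t
    rcases Int.units_eq_one_or b with rfl | rfl
    · push_cast; omega
    · rcases hs.eq_or_lt with rfl | hs
      · exact absurd (by simp [coefFactor, qint_zero]) (left_ne_zero_of_mul hc)
      · push_cast; omega

theorem Phi1_sum_smul {ι : Type*} (S : Finset ι) (c : ι → k) (f : ι → Tens k) :
    Phi1 (∑ i ∈ S, c i • f i) = ∑ i ∈ S, c i • Phi1 (f i) := by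
  simp only [Phi1_def, Finset.sum_mul, smul_mul_assoc]

theorem Phi2_sum_smul (v : k) (s : ℤ) {ι : Type*} (S : Finset ι) (c : ι → k) (f : ι → Tens k) :
    Phi2 v s (∑ i ∈ S, c i • f i) = ∑ i ∈ S, c i • Phi2 v s (f i) := by
  classical
  induction S using Finset.induction_on with
  | empty => simp [Phi2, actF_zero]
  | insert a S ha h =>
    rw [Finset.sum_insert ha, Finset.sum_insert ha, ← h]
    simp only [Phi2, add_mul, actF_add, actF_smul, smul_mul_assoc, smul_add, smul_sub,
      smul_comm (c a)]
    abel

/-- Expansion of `b ⊗ N(w)` for a maximal vector `b`. -/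
def HasExpansion (v : k) (n : ℕ) (w : List ℤˣ) (S : Finset (List ℤˣ)) : Prop :=
  ∀ (s : ℤ) (b : Tens k), IsHighest v s b → s + w.length ≤ n →
    b * natWord v w = ∑ w' ∈ S, coef v s w w' • (w'.foldl (omaxStep v) (s, b)).2

/-- `mul_Psi` with the inner diagram expanded after `Φ_1(b)` and after `Φ_2(b)`. The length bound
keeps `[s+1]` and `[s+2]` among the invertible quantum integers. -/
theorem mul_natWord_nesting {v : k} (hv : v ≠ 0) {n : ℕ} (hn : qfact v n ≠ 0) {e : List ℤˣ}
    (he : ClosedWord e) {S : Finset (List ℤˣ)} (hS : ∀ e' ∈ S, WordCompat e e')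
    (hexp : HasExpansion v n e S) {s : ℤ} {b : Tens k} (hb : IsHighest v s b)
    (hs : s + (e.length + 2) ≤ n) :
    b * Psi v (natWord v e) = ∑ a : ℤˣ, ∑ e' ∈ S,
      coef v s (1 :: (e ++ [-1])) (a :: (e' ++ [-a])) •
        ((a :: (e' ++ [-a])).foldl (omaxStep v) (s, b)).2 := by
  have hne : (-1 : ℤˣ) ≠ 1 := by decide
  have hne' : (1 : ℤˣ) ≠ -1 := by decide
  have h0 := hb.nonneg
  obtain ⟨hK, hF⟩ := natWord_closed hv he
  have hq1 : qint v (s + 1) ≠ 0 := qint_ne_zero hn (by omega) (by omega)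
  have hq2 : qint v (s + 1 + 1) ≠ 0 := qint_ne_zero hn (by omega) (by omega)
  have hsum : ∀ f : ℤˣ → Tens k, ∑ a, f a = f 1 + f (-1) := fun f => by
    rw [show (Finset.univ : Finset ℤˣ) = {1, -1} from rfl, Finset.sum_pair hne']
  have h1 : ∑ e' ∈ S, coef v s (1 :: (e ++ [-1])) (1 :: (e' ++ [-1])) •
      (((1 : ℤˣ) :: (e' ++ [-1])).foldl (omaxStep v) (s, b)).2 =
      (qint v (s + 1))⁻¹ • Phi2 v (s + 1) (Phi1 b * natWord v e) := by
    rw [hexp _ _ (hb.Phi1 hv) (by omega), Phi2_sum_smul, Finset.smul_sum]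
    refine Finset.sum_congr rfl fun e' he' => ?_
    have hc := hS e' he'
    rw [List.foldl_cons, omaxStep_one, foldl_omaxStep_append, hc.psum_eq, he.psum_eq, add_zero,
      List.foldl_cons, List.foldl_nil, omaxStep_neg, coef_cons, coef_append _ _ hc.length_eq,
      coef_cons, coef_nil, smul_smul, hc.psum_eq, he.psum_eq]
    congr 1
    simp only [coefFactor, hne, hne', if_true, if_false, Units.val_one, add_zero]
    field_simp
  have h2 : ∑ e' ∈ S, coef v s (1 :: (e ++ [-1])) (-1 :: (e' ++ [- -1])) •
      (((-1 : ℤˣ) :: (e' ++ [- -1])).foldl (omaxStep v) (s, b)).2 =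
      -((qint v (s + 1))⁻¹ • Phi1 (Phi2 v s b * natWord v e)) := by
    -- At weight `0` the vector `Φ_2(b)` is zero and no longer fits the induction; the coefficients
    -- vanish as well, through their factor at height `0`.
    rcases h0.eq_or_lt with rfl | h0
    · rw [Phi2_zero_eq hb, zero_mul, Phi1_def, zero_mul, smul_zero, neg_zero]
      refine Finset.sum_eq_zero fun e' _ => ?_
      rw [coef_cons, coefFactor, qint_zero]
      simp
    · have hq0 : qint v s ≠ 0 := qint_ne_zero hn h0 (by omega)
      rw [hexp _ _ (hb.Phi2 hv h0) (by omega), Phi1_sum_smul, Finset.smul_sum,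
        ← Finset.sum_neg_distrib]
      refine Finset.sum_congr rfl fun e' he' => ?_
      have hc := hS e' he'
      rw [List.foldl_cons, omaxStep_neg, foldl_omaxStep_append, neg_neg, List.foldl_cons,
        List.foldl_nil, omaxStep_one, coef_cons, coef_append _ _ hc.length_eq, coef_cons, coef_nil,
        smul_smul, ← neg_smul, Units.val_neg, Units.val_one, ← sub_eq_add_neg]
      congr 1
      simp only [coefFactor, hne', if_true, if_false, qint_neg]
      field_simp
  rw [mul_Psi hv hK hF hq1, hsum, h1, h2, smul_sub, sub_eq_add_neg]

theorem HasExpansion.defect {v : k} {n : ℕ} {w : List ℤˣ} {S : Finset (List ℤˣ)}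
    (hS : ∀ w' ∈ S, WordCompat w w') (h : HasExpansion v n w S) :
    HasExpansion v n (w ++ [1]) (S.image (· ++ [1])) := by
  intro s b hb hs
  simp only [List.length_append, List.length_cons, List.length_nil] at hs
  have hne : (1 : ℤˣ) ≠ -1 := by decide
  rw [natWord_defect, ← mul_assoc, h s b hb (by push_cast at hs; omega), ← Phi1_def,
    Phi1_sum_smul, Finset.sum_image fun x _ y _ hxy => List.append_cancel_right hxy]
  refine Finset.sum_congr rfl fun w' hw' => ?_
  rw [coef_append _ _ (hS w' hw').length_eq, foldl_omaxStep_append, List.foldl_cons,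
    List.foldl_nil, omaxStep_one]
  simp [coefFactor, hne]

theorem HasExpansion.link {v : k} (hv : v ≠ 0) {n : ℕ} (hn : qfact v n ≠ 0) {w e : List ℤˣ}
    (he : ClosedWord e) {S T : Finset (List ℤˣ)} (hS : ∀ w' ∈ S, WordCompat w w')
    (hT : ∀ e' ∈ T, WordCompat e e') (h : HasExpansion v n w S) (h2 : HasExpansion v n e T) :
    HasExpansion v n (w ++ 1 :: (e ++ [-1]))
      ((S ×ˢ (Finset.univ : Finset ℤˣ) ×ˢ T).image
        fun p => p.1 ++ p.2.1 :: (p.2.2 ++ [-p.2.1])) := by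
  intro s b hb hs
  simp only [List.length_append, List.length_cons, List.length_nil] at hs
  push_cast at hs
  rw [natWord_link v w he, ← mul_assoc, h s b hb (by omega), Finset.sum_image, Finset.sum_product,
    Finset.sum_mul]
  · refine Finset.sum_congr rfl fun w' hw' => ?_
    have hc := hS w' hw'
    rw [smul_mul_assoc, Finset.sum_product]
    simp only [coef_append _ _ hc.length_eq, foldl_omaxStep_append v w']
    -- A word `w'` that dips below zero need not yield a maximal vector, but then its coefficient is
    -- zero and both sides vanish.
    by_cases h0 : coef v s w w' = 0
    · simp [h0]
    · have hb' := hb.foldl hv (height_nonneg_of_coef_ne_zero hb.nonneg hc.length_eq h0)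
      have hl := psum_le_length w'
      rw [hc.length_eq] at hl
      rw [mul_natWord_nesting hv hn he hT h2 hb' (by omega), Finset.smul_sum]
      refine Finset.sum_congr rfl fun a _ => ?_
      rw [Finset.smul_sum]
      refine Finset.sum_congr rfl fun e' _ => ?_
      rw [smul_smul]
  -- Distinct choices give distinct words: the length of the first piece is fixed, so the
  -- concatenation can be cut apart again.
  · rintro ⟨w₁, a₁, e₁⟩ h₁ ⟨w₂, a₂, e₂⟩ h₂ heq
    simp only [Finset.coe_product, Set.mem_prod, Finset.mem_coe] at h₁ h₂
    have hl := (hS w₁ h₁.1).length_eq.trans (hS w₂ h₂.1).length_eq.symm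
    obtain ⟨rfl, h4⟩ := List.append_inj heq hl
    obtain ⟨rfl, h5⟩ := List.cons.inj h4
    exact congrArg (fun x => (w₁, a₁, x)) (List.append_cancel_right h5)

/-- The first two properties pin down `S` as the set of link reversals of `w`. It may contain words
with negative partial sums, which are not 1-factors. -/
theorem exists_expansion {v : k} (hv : v ≠ 0) {n : ℕ} (hn : qfact v n ≠ 0) {w : List ℤˣ}
    (hw : FactorWord w) :
    ∃ S : Finset (List ℤˣ), (∀ w' ∈ S, WordCompat w w') ∧
      (∀ w', w'.length = w.length → CompatAt w w' → psum w' = psum w → w' ∈ S) ∧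
      HasExpansion v n w S := by
  induction hw with
  | nil =>
    refine ⟨{[]}, by simpa using WordCompat.nil, by simp +contextual, fun s b _ _ => ?_⟩
    simp [natWord_nil]
  | @defect w hw ih =>
    obtain ⟨S, h1, h2, h3⟩ := ih
    refine ⟨_, ?_, ?_, h3.defect h1⟩
    · simp only [Finset.mem_image]
      rintro _ ⟨w', hw', rfl⟩
      exact (h1 w' hw').defect
    · intro w' hlen hc hp
      obtain ⟨u, a, rfl, hu, hcu⟩ := hc.exists_defect hlen
      have h4 := (hw.psum_le hu hcu).1
      rcases Int.units_eq_one_or a with rfl | rfl <;>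
        simp only [psum_append, psum_cons, psum_nil, Units.val_one, Units.val_neg] at hp
      · exact Finset.mem_image.mpr ⟨u, h2 u hu hcu (by omega), rfl⟩
      · omega
  | @link w e hw he hew ih ih2 =>
    obtain ⟨S, h1, h2, h3⟩ := ih
    obtain ⟨T, g1, g2, g3⟩ := ih2
    refine ⟨_, ?_, ?_, h3.link hv hn he h1 g1 g3⟩
    · simp only [Finset.mem_image, Finset.mem_product]
      rintro _ ⟨⟨w', a, e'⟩, ⟨hw', -, he'⟩, rfl⟩
      exact (h1 w' hw').link a he (g1 e' he')
    · intro w' hlen hc hp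
      obtain ⟨u, a, x, rfl, hu, hx, hcu, hcx⟩ := hc.exists_link he hlen
      have h4 := hew.psum_le hx hcx
      rw [he.psum_eq] at h4
      simp only [psum_append, psum_cons, psum_nil, Units.val_one, Units.val_neg, he.psum_eq] at hp
      exact Finset.mem_image.mpr ⟨(u, a, x), Finset.mem_product.mpr ⟨h2 u hu hcu (by omega),
        Finset.mem_product.mpr ⟨Finset.mem_univ a, g2 x hx hcx (by rw [he.psum_eq]; omega)⟩⟩, rfl⟩

/-! ### Orthogonality -/

theorem omaxWord_concat_one (v : k) (w : List ℤˣ) :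
    omaxWord v (w ++ [1]) = Phi1 (omaxWord v w) := by
  rw [omaxWord, foldl_omaxStep_append, List.foldl_cons, List.foldl_nil, omaxStep_one, omaxWord]

theorem omaxWord_concat_neg (v : k) (w : List ℤˣ) :
    omaxWord v (w ++ [-1]) = Phi2 v (psum w) (omaxWord v w) := by
  rw [omaxWord, foldl_omaxStep_append, List.foldl_cons, List.foldl_nil, omaxStep_neg, omaxWord,
    zero_add]

theorem NonnegWord.isHighest {v : k} (hv : v ≠ 0) {w : List ℤˣ} (hw : NonnegWord w) :
    IsHighest v (psum w) (omaxWord v w) := by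
  have h := (IsHighest.one v).foldl hv (w := w) (fun t => by simpa using hw t)
  rwa [zero_add] at h

/-- At the last position where the words differ, one vector lies in the image of `Φ_1` and the other
in that of `Φ_2`. The common letters after it only rescale the form, since equal totals keep the
weights equal. -/
theorem form_omaxWord_eq_zero {v : k} (hv : v ≠ 0) {w w' : List ℤˣ} (hw : NonnegWord w)
    (hw' : NonnegWord w') (hlen : w'.length = w.length) (hp : psum w' = psum w) (hne : w' ≠ w) :
    form (omaxWord v w') (omaxWord v w) = 0 := by
  induction w using List.reverseRecOn generalizing w' with
  | nil => exact absurd (List.length_eq_zero_iff.mp hlen) hne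
  | append_singleton w a ih =>
    rcases List.eq_nil_or_concat' w' with rfl | ⟨w', b, rfl⟩
    · simp at hlen
    have hlen' : w'.length = w.length := by simpa using hlen
    simp only [psum_append, psum_cons, psum_nil, add_zero] at hp
    by_cases hab : b = a
    · subst hab
      have hne' : w' ≠ w := fun h => hne (by rw [h])
      have h := ih hw.left hw'.left hlen' (by omega) hne'
      rcases Int.units_eq_one_or b with rfl | rfl
      · rw [omaxWord_concat_one, omaxWord_concat_one, form_Phi1_Phi1, h]
      · have hp' : psum w' = psum w := by omega
        rw [omaxWord_concat_neg, omaxWord_concat_neg, ← hp',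
          form_Phi2_Phi2 hv (hw'.left.isHighest hv), h, mul_zero]
    · rcases Int.units_eq_one_or b with rfl | rfl <;> rcases Int.units_eq_one_or a with rfl | rfl
      · exact absurd rfl hab
      · rw [omaxWord_concat_one, omaxWord_concat_neg,
          form_Phi1_Phi2 _ (hw'.left.isHighest hv).actE_eq]
      · rw [omaxWord_concat_one, omaxWord_concat_neg, form_comm,
          form_Phi1_Phi2 _ (hw.left.isHighest hv).actE_eq]
      · exact absurd rfl hab

theorem form_omaxWord_ne_zero {v : k} (hv : v ≠ 0) {n : ℕ} (hn : qfact v n ≠ 0) {w : List ℤˣ}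
    (hw : NonnegWord w) (hlen : w.length ≤ n) : form (omaxWord v w) (omaxWord v w) ≠ 0 := by
  induction w using List.reverseRecOn with
  | nil => simp [omaxWord, form_one_one]
  | append_singleton w a ih =>
    simp only [List.length_append, List.length_cons, List.length_nil] at hlen
    have h := ih hw.left (by omega)
    rcases Int.units_eq_one_or a with rfl | rfl
    · rwa [omaxWord_concat_one, form_Phi1_Phi1]
    · have h1 := hw.psum_nonneg
      simp only [psum_append, psum_cons, psum_nil, add_zero, Units.val_neg, Units.val_one] at h1
      have h2 := psum_le_length w
      rw [omaxWord_concat_neg, form_Phi2_Phi2 hv (hw.left.isHighest hv)]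
      exact mul_ne_zero (mul_ne_zero hv (mul_ne_zero (qint_ne_zero hn (by omega) (by omega))
        (qint_ne_zero hn (by omega) (by omega)))) h

/-! ### 1-factors as words -/

section Fin

variable {l : ℕ} (f : Fin l → ℤˣ)

theorem height_ofFn (t : ℕ) :
    height (List.ofFn f) t = ∑ j : Fin l, if (j : ℕ) < t then (f j : ℤ) else 0 := by
  induction l generalizing t with
  | zero => simp [height]
  | succ l ih =>
    rcases t with _ | t
    · simp [height]
    · rw [List.ofFn_succ, height_cons, ih, Fin.sum_univ_succ]
      simp

theorem sum_Iio_eq_height (i : Fin l) :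
    ∑ j ∈ Finset.Iio i, (f j : ℤ) = height (List.ofFn f) i := by
  rw [height_ofFn, ← Finset.sum_filter]
  congr 1
  ext j
  simp

theorem sum_Iic_eq_height (i : Fin l) :
    ∑ j ∈ Finset.Iic i, (f j : ℤ) = height (List.ofFn f) (i + 1) := by
  rw [height_ofFn, ← Finset.sum_filter]
  congr 1
  ext j
  simp only [Finset.mem_Iic, Finset.mem_filter, Finset.mem_univ, true_and]
  omega

theorem height_succ_ofFn (i : Fin l) :
    height (List.ofFn f) (i + 1) = height (List.ofFn f) i + f i := by
  rw [← sum_Iic_eq_height, ← sum_Iio_eq_height, ← Finset.Iio_insert, Finset.sum_insert (by simp),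
    add_comm]

theorem sum_Icc_eq_height {i j : Fin l} (h : i ≤ j) :
    ∑ t ∈ Finset.Icc i j, (f t : ℤ) =
      height (List.ofFn f) (j + 1) - height (List.ofFn f) i := by
  rw [← sum_Iic_eq_height, ← sum_Iio_eq_height, eq_sub_iff_add_eq, ← Finset.sum_union]
  · congr 1
    ext t
    simp only [Finset.mem_union, Finset.mem_Icc, Finset.mem_Iio, Finset.mem_Iic]
    omega
  · rw [Finset.disjoint_left]
    intro t
    simp only [Finset.mem_Icc, Finset.mem_Iio]
    omega

theorem height_of_le {w : List ℤˣ} {t : ℕ} (h : w.length ≤ t) : height w t = psum w := by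
  rw [height, List.take_of_length_le h]

theorem isOneFactor_iff : IsOneFactor f ↔ NonnegWord (List.ofFn f) := by
  constructor
  · intro h t
    rcases t with _ | t
    · rw [height_zero]
    · rcases lt_or_ge t l with ht | ht
      · simpa [sum_Iic_eq_height] using h ⟨t, ht⟩
      · rcases l with _ | l
        · simp [height]
        · have := h (Fin.last l)
          rw [sum_Iic_eq_height, Fin.val_last, height_of_le (by simp)] at this
          rwa [height_of_le (by simp; omega)]
  · intro h i
    rw [sum_Iic_eq_height]
    exact h _

/-- Heights move by `±1`, so a path that starts upwards and does not return to its initial level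
stays strictly above it. -/
theorem paired_iff (i j : Fin l) : Paired f i j ↔ PairedAt (List.ofFn f) i j := by
  constructor
  · rintro ⟨h1, h2, h3, h4⟩
    rw [sum_Icc_eq_height f h2.le] at h3
    refine ⟨h2, by simp, by omega, fun t ht => ?_⟩
    induction t, ht using Nat.le_induction with
    | base =>
      intro _
      rw [Nat.succ_eq_add_one, height_succ_ofFn, h1]
      simp
    | succ t ht ih =>
      intro ht2
      have h5 := ih (by omega)
      have htl : t < l := by omega
      have h6 := h4 ⟨t, htl⟩ (Fin.lt_def.mpr (by simpa using ht))
        (Fin.lt_def.mpr (by simpa using ht2))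
      rw [sum_Icc_eq_height f (Fin.le_def.mpr (by simp; omega))] at h6
      have h7 := height_succ_ofFn f ⟨t, htl⟩
      simp only at h6 h7
      rcases Int.units_eq_one_or (f ⟨t, htl⟩) with h8 | h8 <;> rw [h8] at h7 <;>
        simp only [Units.val_neg, Units.val_one] at h7 <;> omega
  · rintro ⟨h1, h2, h3, h4⟩
    have h1' : i < j := h1
    refine ⟨?_, h1, ?_, fun t ht1 ht2 => ?_⟩
    · have h5 := h4 (i + 1) (by omega) h1
      rw [height_succ_ofFn] at h5
      rcases Int.units_eq_one_or (f i) with h8 | h8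
      · exact h8
      · rw [h8] at h5
        simp at h5
    · rw [sum_Icc_eq_height f h1'.le]; omega
    · have := h4 (t + 1) (by omega) ht2
      rw [sum_Icc_eq_height f ht1.le]; omega

/-- Sending a pair to its right end is a bijection onto the positions of `-1`; nonnegativity of the
partial sums gives every `-1` a partner. -/
theorem numPairings_eq_card (h : IsOneFactor f) :
    numPairings f = (Finset.univ.filter fun i => f i = -1).card := by
  have hw := (isOneFactor_iff f).mp h
  have hinj : Set.InjOn Prod.snd {p : Fin l × Fin l | Paired f p.1 p.2} := by
    rintro ⟨i, j⟩ h1 ⟨i', j'⟩ h2 rfl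
    simp only [Set.mem_ofPred_eq, paired_iff] at h1 h2
    have e1 := h1.height_eq
    have e2 := h2.height_eq
    rcases lt_trichotomy i i' with h3 | rfl | h3
    · have := h1.height_lt i' h3 h2.lt.le
      omega
    · rfl
    · have := h2.height_lt i h3 h1.lt.le
      omega
  rw [numPairings, ← hinj.ncard_image, ← Set.ncard_coe_finset]
  congr 1
  ext j
  simp only [Set.mem_image, Set.mem_ofPred_eq, Prod.exists, exists_eq_right, Finset.coe_filter,
    Finset.mem_univ, true_and, paired_iff]
  have hj := height_succ_ofFn f j
  constructor
  · rintro ⟨i, hp⟩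
    have h1 := hp.height_lt j hp.lt le_rfl
    have h2 := hp.height_eq
    rcases Int.units_eq_one_or (f j) with h3 | h3
    · rw [h3] at hj
      simp only [Units.val_one] at hj
      omega
    · exact h3
  · intro h1
    rw [h1] at hj
    simp only [Units.val_neg, Units.val_one] at hj
    have h0 := hw (j + 1)
    -- The partner of `j` is the last position at or before `j` where the height is at most the
    -- height after `j`; position `0` always qualifies.
    set P : ℕ → Prop := fun t => height (List.ofFn f) t ≤ height (List.ofFn f) (j + 1) with hP
    classical
    have hspec : P (Nat.findGreatest P j) :=
      Nat.findGreatest_spec (Nat.zero_le _) (by rw [hP]; simpa [height_zero] using h0)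
    have hgt : ∀ t, Nat.findGreatest P j < t → t ≤ j → ¬ P t := fun t =>
      Nat.findGreatest_is_greatest
    have hle := Nat.findGreatest_le (P := P) (j : ℕ)
    generalize Nat.findGreatest P j = i at hspec hgt hle
    simp only [hP] at hspec hgt
    have hij : i < j := by
      rcases hle.eq_or_lt with rfl | h2
      · omega
      · exact h2
    have h2 := hgt (i + 1) (by omega) hij
    have h3 := height_succ_ofFn f ⟨i, hij.trans j.2⟩
    simp only at h3
    have h4 : height (List.ofFn f) i = height (List.ofFn f) (j + 1) := by
      rcases Int.units_eq_one_or (f ⟨i, hij.trans j.2⟩) with h8 | h8 <;> rw [h8] at h3 <;>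
        simp only [Units.val_neg, Units.val_one] at h3 <;> omega
    refine ⟨⟨i, hij.trans j.2⟩, hij, by simp, h4.symm, fun t ht1 ht2 => ?_⟩
    have := hgt t ht1 ht2
    simp only at ht1 ⊢
    omega

theorem psum_ofFn : psum (List.ofFn f) = l - 2 * (Finset.univ.filter fun i => f i = -1).card := by
  have h : psum (List.ofFn f) = ∑ i, (f i : ℤ) := by
    rw [← height_length, height_ofFn]
    simp
  have hf : ∀ i, (f i : ℤ) = 1 - 2 * if f i = -1 then 1 else 0 := by
    intro i
    have hne : (1 : ℤˣ) ≠ -1 := by decide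
    rcases Int.units_eq_one_or (f i) with h | h <;> simp [h, hne]
  rw [h, Finset.sum_congr rfl fun i _ => hf i, Finset.sum_sub_distrib, ← Finset.mul_sum,
    Finset.sum_boole]
  simp

theorem coef_ofFn (v : k) (g : Fin l → ℤˣ) (s : ℤ) :
    coef v s (List.ofFn f) (List.ofFn g) =
      ∏ j : Fin l, coefFactor v (s + height (List.ofFn g) j) (f j) (g j) := by
  induction l generalizing s with
  | zero => simp
  | succ l ih =>
    rw [List.ofFn_succ, List.ofFn_succ, coef_cons, ih, Fin.prod_univ_succ]
    simp [height_cons, height_zero, add_assoc]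

end Fin

/-! ### The transition matrix between 1-factors of a fixed shape -/

variable {l m : ℕ}

theorem OneFactor.nonnegWord (α : OneFactor l m) : NonnegWord (List.ofFn α.entry) :=
  (isOneFactor_iff _).mp α.isOneFactor

theorem OneFactor.psum_eq (α : OneFactor l m) : psum (List.ofFn α.entry) = l - 2 * m := by
  rw [psum_ofFn, ← numPairings_eq_card _ α.isOneFactor, α.numPairings_eq]

theorem OneFactor.eq_of_word_eq {α β : OneFactor l m}
    (h : List.ofFn α.entry = List.ofFn β.entry) : α = β :=
  OneFactor.entry_injective l m (List.ofFn_injective h)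

theorem OneFactor.exists_word_eq (α : OneFactor l m) {w : List ℤˣ} (hw : NonnegWord w)
    (hlen : w.length = l) (hp : psum w = l - 2 * m) :
    ∃ β : OneFactor l m, List.ofFn β.entry = w := by
  subst hlen
  have h : List.ofFn w.get = w := List.ofFn_get w
  have h1 : IsOneFactor w.get := (isOneFactor_iff _).mpr (by rwa [h])
  refine ⟨⟨w.get, h1, ?_⟩, h⟩
  have h2 := psum_ofFn w.get
  rw [h, ← numPairings_eq_card _ h1, hp] at h2
  omega

theorem compatible_iff (α β : OneFactor l m) :
    Compatible α β ↔ CompatAt (List.ofFn α.entry) (List.ofFn β.entry) := by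
  have hget : ∀ i : Fin l, (List.ofFn β.entry).getD i 1 = β.entry i := by
    intro i
    rw [List.getD_eq_getElem _ _ (by simp), List.getElem_ofFn]
  constructor
  · intro h i j hp
    have hj : j < l := by simpa using hp.lt_length
    have hi : i < l := hp.lt.trans hj
    have := h ⟨i, hi⟩ ⟨j, hj⟩ ((paired_iff _ _ _).mpr hp)
    rwa [← hget, ← hget] at this
  · intro h i j hp
    have := h i j ((paired_iff _ _ _).mp hp)
    rwa [hget, hget] at this

theorem sBefore_eq_height (β : OneFactor l m) (i : Fin l) :
    sBefore β i = height (List.ofFn β.entry) i := sum_Iio_eq_height _ i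

theorem coef_eq_prod_negPos (v : k) (α β : OneFactor l m) :
    coef v 0 (List.ofFn α.entry) (List.ofFn β.entry) = ∏ j ∈ negPos β,
      qint v (sPrime α β j) / (qint v (sBefore β j) * qint v (sBefore β j + 1)) := by
  rw [coef_ofFn, negPos, Finset.prod_filter]
  refine Finset.prod_congr rfl fun j _ => ?_
  rw [coefFactor, zero_add, ← sBefore_eq_height, sPrime]

/-- The closed formula for the transition coefficients. -/
def transCoef (v : k) (α β : OneFactor l m) : k :=
  open Classical in
  if Compatible α β then coef v 0 (List.ofFn α.entry) (List.ofFn β.entry) else 0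

theorem isTransition_transCoef {v : k} (hv : v ≠ 0) {n : ℕ} (hn : qfact v n ≠ 0) (hl : l ≤ n) :
    IsTransition v (transCoef v : OneFactor l m → OneFactor l m → k) := by
  classical
  intro α
  obtain ⟨S, h1, h2, h3⟩ := exists_expansion hv hn α.nonnegWord.factorWord
  have h4 := h3 0 1 (IsHighest.one v) (by simpa using hl)
  rw [one_mul] at h4
  let word : OneFactor l m → List ℤˣ := fun β => List.ofFn β.entry
  have hinj : Function.Injective word := fun β γ h => OneFactor.eq_of_word_eq h
  have h5 : ∀ β : OneFactor l m, transCoef v α β • omax v β =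
      (if CompatAt (List.ofFn α.entry) (word β) then coef v 0 (List.ofFn α.entry) (word β) else 0)
        • omaxWord v (word β) := by
    intro β
    simp only [transCoef, compatible_iff, word, omax]
  rw [natMax, h4, Finset.sum_congr rfl fun β _ => h5 β,
    ← Finset.sum_image (s := Finset.univ) (g := word) (f := fun w =>
      (if CompatAt (List.ofFn α.entry) w then coef v 0 (List.ofFn α.entry) w else 0)
        • omaxWord v w) (hinj.injOn)]
  -- The two index sets may differ: words of `S` that are not 1-factors have coefficient zero, and
  -- 1-factors outside `S` are not compatible.
  refine Finset.sum_congr_of_eq_on_inter ?_ ?_ ?_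
  · intro w hw hw'
    have hc := h1 w hw
    by_cases h0 : coef v 0 (List.ofFn α.entry) w = 0
    · rw [h0, zero_smul]
    · have hnn := height_nonneg_of_coef_ne_zero le_rfl hc.length_eq h0
      obtain ⟨β, rfl⟩ := α.exists_word_eq (fun t => by simpa using hnn t)
        (by simp [hc.length_eq]) (by rw [hc.psum_eq, α.psum_eq])
      exact absurd (Finset.mem_image_of_mem word (Finset.mem_univ β)) hw'
  · intro w hw hw'
    obtain ⟨β, -, rfl⟩ := Finset.mem_image.mp hw
    rw [if_neg, zero_smul]
    exact fun hc => hw' (h2 _ (by simp [word]) hc (by simp only [word]; rw [β.psum_eq, α.psum_eq]))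
  · intro w hw _
    rw [if_pos (h1 w hw).compatAt, omaxWord]

theorem form_omax_ne_zero {v : k} (hv : v ≠ 0) {n : ℕ} (hn : qfact v n ≠ 0) (hl : l ≤ n)
    (β : OneFactor l m) : form (omax v β) (omax v β) ≠ 0 :=
  form_omaxWord_ne_zero hv hn β.nonnegWord (by simpa using hl)

/-- Pairing the expansion with `ω(β)` isolates one term. The quotient does not involve `π`, so this
also yields uniqueness. -/
theorem IsTransition.eq_div {v : k} (hv : v ≠ 0) {n : ℕ} (hn : qfact v n ≠ 0) (hl : l ≤ n)
    {π : OneFactor l m → OneFactor l m → k} (h : IsTransition v π) (α β : OneFactor l m) :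
    π α β = form (natMax v α) (omax v β) / form (omax v β) (omax v β) := by
  rw [eq_div_iff (form_omax_ne_zero hv hn hl β), h α, form_sum_left, Finset.sum_eq_single β,
    form_smul_left]
  · intro γ _ hγ
    rw [form_smul_left, omax, omax, form_omaxWord_eq_zero hv β.nonnegWord γ.nonnegWord (by simp)
      (by rw [β.psum_eq, γ.psum_eq]) fun h => hγ (OneFactor.eq_of_word_eq h), mul_zero]
  · intro h
    exact absurd (Finset.mem_univ β) h

theorem IsTransition.eq_transCoef {v : k} (hv : v ≠ 0) {n : ℕ} (hn : qfact v n ≠ 0) (hl : l ≤ n)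
    {π : OneFactor l m → OneFactor l m → k} (h : IsTransition v π) : π = transCoef v := by
  funext α β
  rw [h.eq_div hv hn hl, (isTransition_transCoef hv hn hl).eq_div hv hn hl]

theorem Compatible.below {α β : OneFactor l m} (h : Compatible α β) : Below β α := by
  intro i
  rw [sum_Iic_eq_height, sum_Iic_eq_height]
  exact (α.nonnegWord.factorWord.wordCompat (by simp) ((compatible_iff _ _).mp h)
    (by rw [β.psum_eq, α.psum_eq])).height_le _

/-- The partial sum after a `-1` is still nonnegative, so the one before is at least `1`; it is also
at most the number of preceding positions, which is less than `l`. -/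
theorem sBefore_bounds {β : OneFactor l m} {j : Fin l} (hj : j ∈ negPos β) :
    0 < sBefore β j ∧ sBefore β j + 1 ≤ l := by
  have h1 := β.nonnegWord (j + 1)
  have h2 := height_le_natCast (List.ofFn β.entry) j
  rw [height_succ_ofFn, (Finset.mem_filter.mp hj).2, Units.val_neg, Units.val_one] at h1
  rw [sBefore_eq_height]
  omega

theorem sBefore_qint_ne_zero {v : k} {n : ℕ} (hn : qfact v n ≠ 0) (hl : l ≤ n)
    {β : OneFactor l m} {j : Fin l} (hj : j ∈ negPos β) :
    qint v (sBefore β j) ≠ 0 ∧ qint v (sBefore β j + 1) ≠ 0 := by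
  obtain ⟨h1, h2⟩ := sBefore_bounds hj
  exact ⟨qint_ne_zero hn h1 (by omega), qint_ne_zero hn (by omega) (by omega)⟩

end OrthTL

end

open OrthTL
theorem corollaryc {k : Type*} [Field k] (v : k) (hv : v ≠ 0) (n : ℕ) (hn : qfact v n ≠ 0)
    (l m : ℕ) (hl : l ≤ n) :
    (∃! π : OneFactor l m → OneFactor l m → k, IsTransition v π) ∧
    ∀ π : OneFactor l m → OneFactor l m → k, IsTransition v π →
      ∀ α β : OneFactor l m,
        (¬ Below β α → π α β = 0) ∧
        form (omax v β) (omax v β) ≠ 0 ∧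
        π α β = form (natMax v α) (omax v β) / form (omax v β) (omax v β) ∧
        (∀ j ∈ negPos β, qint v (sBefore β j) ≠ 0 ∧ qint v (sBefore β j + 1) ≠ 0) ∧
        (Compatible α β →
          π α β = ∏ j ∈ negPos β,
            qint v (sPrime α β j) / (qint v (sBefore β j) * qint v (sBefore β j + 1))) ∧
        (¬ Compatible α β → π α β = 0) ∧
        (Compatible α β →
          ∃ (ε : ℤˣ) (r : Fin l → ℤ),
            (∀ j ∈ negPos β,
              (r j = sBefore β j ∨ r j = sBefore β j + 1) ∧ qint v (r j) ≠ 0) ∧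
            π α β = ((ε : ℤ) : k) * (∏ j ∈ negPos β, qint v (r j))⁻¹) := by
  refine ⟨⟨transCoef v, isTransition_transCoef hv hn hl, fun π h => h.eq_transCoef hv hn hl⟩, ?_⟩
  intro π hπ α β
  have hnot : ¬ Compatible α β → π α β = 0 := fun h => by
    rw [hπ.eq_transCoef hv hn hl, transCoef, if_neg h]
  have hprod : Compatible α β → π α β = ∏ j ∈ negPos β,
      qint v (sPrime α β j) / (qint v (sBefore β j) * qint v (sBefore β j + 1)) := fun h => by
    rw [hπ.eq_transCoef hv hn hl, transCoef, if_pos h, coef_eq_prod_negPos]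
  have hq : ∀ j ∈ negPos β, qint v (sBefore β j) ≠ 0 ∧ qint v (sBefore β j + 1) ≠ 0 :=
    fun j hj => sBefore_qint_ne_zero hn hl hj
  refine ⟨fun h => hnot fun hc => h hc.below, form_omax_ne_zero hv hn hl β,
    hπ.eq_div hv hn hl α β, hq, hprod, hnot, fun hc => ?_⟩
  -- One quantum integer cancels in each factor: `[-s]/([s][s+1]) = -1/[s+1]` when the entry of `α`
  -- is `1`, and `[s+1]/([s][s+1]) = 1/[s]` when it is `-1`.
  refine ⟨∏ j ∈ negPos β, if α.entry j = 1 then -1 else 1,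
    fun j => if α.entry j = 1 then sBefore β j + 1 else sBefore β j, fun j hj => ?_, ?_⟩
  · dsimp only
    split_ifs
    · exact ⟨.inr rfl, (hq j hj).2⟩
    · exact ⟨.inl rfl, (hq j hj).1⟩
  · rw [hprod hc, Units.coe_prod, Int.cast_prod, ← Finset.prod_inv_distrib,
      ← Finset.prod_mul_distrib]
    refine Finset.prod_congr rfl fun j hj => ?_
    obtain ⟨h1, h2⟩ := hq j hj
    by_cases h : α.entry j = 1
    · simp only [sPrime, h, if_true, qint_neg]
      push_cast
      field_simp
    · simp only [sPrime, h, if_false]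
      push_cast
      field_simp
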